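/- Let $r_p,r_I,R_p,R_I>0$. Consider the following random network in $\mathbb R^2$ with densities $\lambda_S,\lambda_{PT}>0$. The secondary users form a homogeneous Poisson point process of density $\lambda_S$. The primary transmitters form a homogeneous Poisson point process of density $\lambda_{PT}$; given the transmitters, each of them has one receiver, the receivers are independent, and each is uniformly distributed in the disk of radius $R_p$ about its transmitter. The secondary users are independent of the primary network. A location $a$ *sees an opportunity* if no primary receiver is within distance $r_I$ of $a$ and no primary transmitter is within distance $R_I$ of $a$. Two distinct secondary users are joined by a link if they are at distance at most $r_p$ and both see an opportunity; $\deg(A)$ is the number of links of the secondary user $A$. The conditional average degree of a secondary user is $$\mu=\mathbb E[\deg(A)\mid A\text{ sees an opportunity}],$$ where $A$ is an arbitrarily chosen (typical) secondary user, that is, for a Borel set $W$ of positive finite area, $\mu$ is the expected sum of $\deg(A)$ over the users $A\in W$ that see an opportunity, divided by the expected number of such users; or, alternatively, $A$ is an additional user placed at a fixed location $a$. For $t\ge 0$ let $S_I(t,r_1,r_2)$ be the common area of two disks with radii $r_1$ and $r_2$ whose centers are $t$ apart, let $\mathcal S_{U2}(t,r_1,r_2)$ be the union of two disks with radii $r_1,r_2$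 whose centers are $t$ apart, the origin being the middle point of the centers, let $S_{I2}(r,\theta,R_p,t,r_I)$ be the area of the intersection of $\mathcal S_{U2}(t,r_I,r_I)$ with the disk of radius $R_p$ centered at the point with polar coordinates $(r,\theta)$, and let $$I(R_I,R_p,r_I)=2\int_0^{R_I}t\,\frac{S_I(t,R_p,r_I)}{\pi R_p^2}\,dt .$$ Define $$g(\lambda_{PT},r_p,r_I,R_p,R_I)=\int_0^{r_p}\frac{2t}{r_p^2}\exp\Big\{-\lambda_{PT}\Big[\pi\big(r_I^2+R_I^2+I(R_I,R_p,r_I)\big)-S_I(t,r_I,r_I)-S_I(t,R_I,R_I)-\iint_{\mathcal S_{U2}(t,R_I,R_I)}\frac{S_{I2}(r,\theta,R_p,t,r_I)}{\pi R_p^2}\,r\,dr\,d\theta\Big]\Big\}\,dt .$$ Then: 1. for every location $a$, $g(\lambda_{PT},r_p,r_I,R_p,R_I)$ is the conditional probability, given that $a$ sees an opportunity, that $a$ and $B$ both see an opportunity, where $B$ is uniformly distributed in the disk of radius $r_p$ about $a$ and independent of the primary network; 2. in both of the above senses (for every $W$ and for every $a$), the conditional average degree of a secondary user is $$\mu=\lambda_S\,\pi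 r_p^2\cdot g(\lambda_{PT},r_p,r_I,R_p,R_I);$$ 3. for fixed $r_p,r_I,R_p,R_I$, $g$ is strictly decreasing in $\lambda_{PT}\in[0,\infty)$. -/

import Mathlib

open MeasureTheory ProbabilityTheory
open scoped ENNReal

noncomputable section

namespace HetNet

/-- The Euclidean plane. -/
abbrev Plane : Type := EuclideanSpace ℝ (Fin 2)

/-! ### The network model -/

/-- The number of points of the family `x` that lie in `B`. -/
def pointCount {ι : Type*} (x : ι → Plane) (B : Set Plane) : ℕ∞ :=
  {i | x i ∈ B}.encard

/-- The random points `X 0, X 1, X 2, …` form a (homogeneous) Poisson point process of density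
`lam` on the plane: the number of points in a measurable set `B` of finite area is
Poisson distributed with mean `lam * area B`, and the numbers of points in disjoint sets are
independent. (For `lam > 0` there are almost surely infinitely many points, and they are almost
surely distinct, so the process can be listed as a sequence.) -/
structure IsPoissonProcess {Ω : Type*} [MeasurableSpace Ω] (P : Measure Ω) (lam : ℝ)
    (X : ℕ → Ω → Plane) : Prop where
  measurable : ∀ i, Measurable (X i)
  law : ∀ B : Set Plane, MeasurableSet B → volume B ≠ ∞ → ∀ k : ℕ,
    P {ω | pointCount (fun i => X i ω) B = k}
      = poissonMeasure (lam * volume.real B).toNNReal {k}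
  indep : ∀ (n : ℕ) (B : Fin n → Set Plane), (∀ m, MeasurableSet (B m)) →
    (∀ m, volume (B m) ≠ ∞) → Pairwise (Function.onFun Disjoint B) →
    iIndepFun (fun m ω => pointCount (fun i => X i ω) (B m)) P

/-- The uniform distribution on the closed disk of radius `r` about `a`. -/
def uniformDisk (a : Plane) (r : ℝ) : Measure Plane :=
  ProbabilityTheory.cond volume (Metric.closedBall a r)

/-- A Poisson secondary network overlaid with a Poisson primary network. `su` lists the secondary
users, `tx` the primary transmitters, and `rx i` is the receiver of the transmitter `tx i`.
Given the transmitters, the receivers are independent, each one uniformly distributed within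
distance `Rp` of its transmitter; the secondary users are independent of the primary network. -/
structure IsNetwork {Ω : Type*} [MeasurableSpace Ω] (P : Measure Ω) (lamS lamPT Rp : ℝ)
    (su tx rx : ℕ → Ω → Plane) : Prop where
  secondary : IsPoissonProcess P lamS su
  transmitters : IsPoissonProcess P lamPT tx
  measurable_rx : ∀ i, Measurable (rx i)
  uniform_rx : ∀ i, P.map (fun ω => rx i ω - tx i ω) = uniformDisk 0 Rp
  iIndep_rx : iIndepFun (fun i ω => rx i ω - tx i ω) P
  indep_tx_rx : IndepFun (fun ω i => tx i ω) (fun ω i => rx i ω - tx i ω) P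
  indep_secondary : IndepFun (fun ω i => su i ω) (fun ω i => (tx i ω, rx i ω)) P

/-- A secondary user located at `a` sees an opportunity: no primary receiver is within distance
`rI` of `a` and no primary transmitter is within distance `RI` of `a`. -/
def SeesOpportunity (tx rx : ℕ → Plane) (rI RI : ℝ) (a : Plane) : Prop :=
  (¬ ∃ i, dist (rx i) a ≤ rI) ∧ ¬ ∃ i, dist (tx i) a ≤ RI

/-- The graph of bidirectional links between secondary users at the locations `s`. -/
def linkGraph {ι : Type*} (s : ι → Plane) (tx rx : ℕ → Plane) (rp rI RI : ℝ) :
    SimpleGraph ι where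
  Adj i j := i ≠ j ∧ dist (s i) (s j) ≤ rp ∧
    SeesOpportunity tx rx rI RI (s i) ∧ SeesOpportunity tx rx rI RI (s j)
  symm := ⟨fun i j h => ⟨h.1.symm, by rw [dist_comm]; exact h.2.1, h.2.2.2, h.2.2.1⟩⟩
  loopless := ⟨fun _ h => h.1 rfl⟩

/-- The degree of a secondary user in the graph of bidirectional links. -/
def deg {ι : Type*} (s : ι → Plane) (tx rx : ℕ → Plane) (rp rI RI : ℝ) (i : ι) : ℝ≥0∞ :=
  ((((linkGraph s tx rx rp rI RI).neighborSet i).encard : ℕ∞) : ℝ≥0∞)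

open Classical in
/-- The conditional average degree of a secondary user chosen arbitrarily among those that lie in
the window `W`, given that it sees an opportunity (the conditional expectation under the Palm
distribution of the process of secondary users): the expected sum of the degrees of all users in
`W` that see an opportunity, divided by the expected number of these users. -/
def condAvgDegree {Ω : Type*} [MeasurableSpace Ω] (P : Measure Ω) (su tx rx : ℕ → Ω → Plane)
    (rp rI RI : ℝ) (W : Set Plane) : ℝ≥0∞ :=
  (∫⁻ ω, ∑' i, if su i ω ∈ W ∧ SeesOpportunity (tx · ω) (rx · ω) rI RI (su i ω)
      then deg (su · ω) (tx · ω) (rx · ω) rp rI RI i else 0 ∂P)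
    / ∫⁻ ω, ∑' i, if su i ω ∈ W ∧ SeesOpportunity (tx · ω) (rx · ω) rI RI (su i ω)
      then 1 else 0 ∂P

/-- The event that a secondary user at `a` sees an opportunity. -/
def oppEvent {Ω : Type*} (tx rx : ℕ → Ω → Plane) (rI RI : ℝ) (a : Plane) : Set Ω :=
  {ω | SeesOpportunity (tx · ω) (rx · ω) rI RI a}

/-- The locations of the secondary users when a user `A = none` at the location `a` is added. -/
def addUser (a : Plane) (s : ℕ → Plane) : Option ℕ → Plane :=
  fun o => o.elim a s

/-- The conditional average degree `E[deg A | A sees an opportunity]` of a secondary user `A` that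
is placed at a given location `a`, the other users being the points of the process. -/
def condAvgDegreeAt {Ω : Type*} [MeasurableSpace Ω] (P : Measure Ω) (su tx rx : ℕ → Ω → Plane)
    (rp rI RI : ℝ) (a : Plane) : ℝ≥0∞ :=
  ∫⁻ ω, deg (addUser a (su · ω)) (tx · ω) (rx · ω) rp rI RI none
    ∂(ProbabilityTheory.cond P (oppEvent tx rx rI RI a))

/-- The conditional probability of a bidirectional opportunity between a user at `a` and a user
at a location `b` that is uniform within distance `rp` of `a` and independent of the primary
network, given that the user at `a` sees an opportunity. -/
def condBidirProb {Ω : Type*} [MeasurableSpace Ω] (P : Measure Ω) (tx rx : ℕ → Ω → Plane)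
    (rp rI RI : ℝ) (a : Plane) : ℝ :=
  (ProbabilityTheory.cond (P.prod (uniformDisk a rp))
      {p : Ω × Plane | p.1 ∈ oppEvent tx rx rI RI a}).real
    {p : Ω × Plane | p.1 ∈ oppEvent tx rx rI RI a ∧ p.1 ∈ oppEvent tx rx rI RI p.2}

/-! ### The explicit formula -/

/-- The common area of two disks with radii `r₁`, `r₂` whose centers are `t` apart. -/
def SI (t r₁ r₂ : ℝ) : ℝ :=
  volume.real (Metric.closedBall (!₂[0, 0] : Plane) r₁ ∩ Metric.closedBall (!₂[t, 0] : Plane) r₂)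

/-- The union of two disks with radii `r₁`, `r₂` whose centers are `t` apart; the origin is the
middle point of the two centers. -/
def SU2 (t r₁ r₂ : ℝ) : Set Plane :=
  Metric.closedBall !₂[-t / 2, 0] r₁ ∪ Metric.closedBall !₂[t / 2, 0] r₂

/-- The point with polar coordinates `(r, θ)`. -/
def polarPoint (r θ : ℝ) : Plane :=
  !₂[r * Real.cos θ, r * Real.sin θ]

/-- The area of the intersection of the disk of radius `Rp` centered at the point with polar
coordinates `(r, θ)` with the union of two disks of radius `rI` whose centers are `t` apart. -/
def SI2 (r θ Rp t rI : ℝ) : ℝ :=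
  volume.real (Metric.closedBall (polarPoint r θ) Rp ∩ SU2 t rI rI)

/-- `I(RI, Rp, rI)`. -/
def II (RI Rp rI : ℝ) : ℝ :=
  2 * ∫ t in (0 : ℝ)..RI, t * (SI t Rp rI / (Real.pi * Rp ^ 2))

/-- The double integral, in polar coordinates, of `SI2 / (π Rp²)` over `SU2 t RI RI`. -/
def doubleIntegral (t rI Rp RI : ℝ) : ℝ :=
  ∫ p in {p : ℝ × ℝ | 0 < p.1 ∧ p.2 ∈ Set.Ioo (-Real.pi) Real.pi ∧
      polarPoint p.1 p.2 ∈ SU2 t RI RI},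
    SI2 p.1 p.2 Rp t rI / (Real.pi * Rp ^ 2) * p.1

/-- The explicit expression for `g`. -/
def g (lamPT rp rI Rp RI : ℝ) : ℝ :=
  ∫ t in (0 : ℝ)..rp, 2 * t / rp ^ 2 *
    Real.exp (-lamPT * (Real.pi * (rI ^ 2 + RI ^ 2 + II RI Rp rI)
      - SI t rI rI - SI t RI RI - doubleIntegral t rI Rp RI))

end HetNet

end

noncomputable section

namespace HetNet

/-! Write each receiver as its transmitter plus an offset. The offsets are independent, uniform in a
disk and independent of the transmitters, so transmitters with offsets form a marked Poisson process
on `Plane × Plane` with intensity `lamPT` times area ⊗ uniform law. Two locations `a`, `b` both see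
an opportunity exactly when no marked point falls in a certain set: transmitter in the union of the
`RI`-disks, or receiver in the union of the `rI`-disks. The probability of this is `exp (-lamPT *
coverage)`, where `coverage` is the measure of that set (`measure_forall_notMem`).

Inclusion–exclusion evaluates `coverage`. The receiver condition alone has the area of the target
set as its measure, since a translation by any offset preserves area. The overlap is an integral
over transmitters of the chance that the receiver hits the target. For `a = b` this gives
`baseCoverage`; for distance `t` it gives `baseCoverage` plus exactly the exponent `excess` of `g`
(`coverage_twoDisks`). Dividing, the conditional probability that `b` sees an opportunity, given
that `a` does, is `exp (-lamPT * excess)` at `t = dist a b`, and averaging over the disk about `a`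
in polar coordinates yields `g`.

For degrees, the independence of secondary and primary networks permits freezing the primary one.
For an added user, Campbell's formula counts neighbours with intensity `lamS`. For a user of the
process, the second factorial moment measure `lamS ^ 2` times area ⊗ area counts ordered pairs of
distinct users; the density, the window area and the probability of an opportunity cancel in the
quotient.

Strict monotonicity needs `0 < excess` for `t > 0`: a second location strictly enlarges the set of
forbidden marks by a set of positive measure (`coverage_closedBall_lt_coverage_twoDisks`). -/

lemma toENNReal_pointCount {ι : Type*} (x : ι → Plane) (B : Set Plane) :
    ((pointCount x B : ℕ∞) : ℝ≥0∞) = ∑' i, B.indicator 1 (x i) := by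
  rw [pointCount, ← ENNReal.tsum_set_one, tsum_subtype {i | x i ∈ B} (fun _ => (1 : ℝ≥0∞))]
  rfl

/-! ### Moments and generating function of the Poisson distribution -/

section PoissonMoments

open scoped Nat

lemma lintegral_poissonMeasure (r : NNReal) (f : ℕ → ℝ≥0∞) :
    ∫⁻ n, f n ∂poissonMeasure r
      = ∑' n : ℕ, ENNReal.ofReal (Real.exp (-r) * r ^ n / n !) * f n := by
  simp [poissonMeasure, lintegral_sum_measure, lintegral_smul_measure]

/-- The weight identity `n * r ^ n / n! = r * r ^ (n - 1) / (n - 1)!` shifts the index; the first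
two moments follow from it. -/
lemma lintegral_poissonMeasure_nat_mul (r : NNReal) (f : ℕ → ℝ≥0∞) :
    ∫⁻ n, n * f n ∂poissonMeasure r = r * ∫⁻ n, f (n + 1) ∂poissonMeasure r := by
  rw [lintegral_poissonMeasure, lintegral_poissonMeasure, tsum_eq_zero_add' ENNReal.summable,
    ← ENNReal.tsum_mul_left]
  simp only [Nat.cast_zero, zero_mul, mul_zero, zero_add]
  refine tsum_congr fun n => ?_
  have h : ENNReal.ofReal (Real.exp (-r) * r ^ (n + 1) / (n + 1)!) * ((n + 1 : ℕ) : ℝ≥0∞)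
      = r * ENNReal.ofReal (Real.exp (-r) * r ^ n / n !) := by
    rw [← ENNReal.ofReal_natCast, ← ENNReal.ofReal_coe_nnreal, ← ENNReal.ofReal_mul (by positivity),
      ← ENNReal.ofReal_mul (by positivity)]
    congr 1
    rw [Nat.factorial_succ]
    push_cast
    field_simp
    ring
  rw [← mul_assoc, h, mul_assoc]

lemma lintegral_poissonMeasure_id (r : NNReal) : ∫⁻ n : ℕ, (n : ℝ≥0∞) ∂poissonMeasure r = r := by
  simpa using lintegral_poissonMeasure_nat_mul r (fun _ => 1)

lemma lintegral_poissonMeasure_mul_self (r : NNReal) :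
    ∫⁻ n : ℕ, (n : ℝ≥0∞) * n ∂poissonMeasure r = r * r + r := by
  rw [lintegral_poissonMeasure_nat_mul r (fun n => (n : ℝ≥0∞))]
  simp only [Nat.cast_add, Nat.cast_one]
  rw [lintegral_add_right _ measurable_const, lintegral_poissonMeasure_id]
  simp [mul_add]

lemma lintegral_poissonMeasure_pow (r : NNReal) {c : ℝ} (hc : 0 ≤ c) :
    ∫⁻ n : ℕ, ENNReal.ofReal c ^ n ∂poissonMeasure r
      = ENNReal.ofReal (Real.exp (-(r * (1 - c)))) := by
  rw [lintegral_poissonMeasure]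
  have h : HasSum (fun n : ℕ => Real.exp (-r) * ((r * c) ^ n / n !))
      (Real.exp (-r) * Real.exp (r * c)) := by
    rw [Real.exp_eq_exp_ℝ]
    exact (NormedSpace.expSeries_div_hasSum_exp ((r : ℝ) * c)).mul_left _
  rw [show -((r : ℝ) * (1 - c)) = -r + r * c by ring, Real.exp_add, ← h.tsum_eq,
    ENNReal.ofReal_tsum_of_nonneg (fun n => by positivity) h.summable]
  refine tsum_congr fun n => ?_
  rw [← ENNReal.ofReal_pow hc, ← ENNReal.ofReal_mul (by positivity)]
  congr 1
  rw [mul_pow]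
  ring

end PoissonMoments

/-! ### Distribution of the counts of a Poisson process -/

namespace IsPoissonProcess

variable {Ω : Type*} [MeasurableSpace Ω] {P : Measure Ω} {lam : ℝ} {X : ℕ → Ω → Plane}

lemma measurable_pointCount (hX : IsPoissonProcess P lam X) {B : Set Plane}
    (hB : MeasurableSet B) : Measurable fun ω => pointCount (X · ω) B := by
  have h : Measurable fun ω => ((pointCount (X · ω) B : ℕ∞) : ℝ≥0∞) := by
    simp_rw [toENNReal_pointCount]
    exact Measurable.tsum fun i => (measurable_one.indicator hB).comp (hX.measurable i)
  refine ENat.measurable_iff.2 fun n => ?_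
  have : (fun ω => pointCount (X · ω) B) ⁻¹' {(n : ℕ∞)}
      = (fun ω => ((pointCount (X · ω) B : ℕ∞) : ℝ≥0∞)) ⁻¹' {(n : ℝ≥0∞)} := by
    ext ω
    simp only [Set.mem_preimage, Set.mem_singleton_iff]
    rw [← ENat.toENNReal_coe, ENat.toENNReal_inj]
  rw [this]
  exact h (measurableSet_singleton _)

lemma map_pointCount [IsProbabilityMeasure P] (hX : IsPoissonProcess P lam X) {B : Set Plane}
    (hB : MeasurableSet B) (hB' : volume B ≠ ∞) :
    P.map (fun ω => pointCount (X · ω) B)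
      = (poissonMeasure (lam * volume.real B).toNNReal).map ((↑) : ℕ → ℕ∞) := by
  have hm := hX.measurable_pointCount hB
  have : IsProbabilityMeasure (P.map (fun ω => pointCount (X · ω) B)) :=
    Measure.isProbabilityMeasure_map hm.aemeasurable
  have hfin : ∀ k : ℕ, P.map (fun ω => pointCount (X · ω) B) {(k : ℕ∞)}
      = poissonMeasure (lam * volume.real B).toNNReal {k} := fun k => by
    rw [Measure.map_apply hm (measurableSet_singleton _)]
    exact hX.law B hB hB' k
  have hcast : ∀ k : ℕ, ((↑) : ℕ → ℕ∞) ⁻¹' {(k : ℕ∞)} = {k} := fun k => by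
    ext; simp
  -- The definition prescribes only the probabilities of finite counts; these already sum to one, so
  -- nothing is left for `⊤`.
  have htop : P.map (fun ω => pointCount (X · ω) B) {⊤} = 0 := by
    have hc : ({⊤} : Set ℕ∞) = (⋃ k : ℕ, {(k : ℕ∞)})ᶜ := by
      ext x
      cases x <;> simp
    rw [hc, prob_compl_eq_zero_iff (MeasurableSet.of_discrete),
      measure_iUnion (fun i j hij => by simpa [Function.onFun] using hij) (fun _ => .of_discrete)]
    simp_rw [hfin]
    rw [← measure_iUnion (fun i j hij => by simpa [Function.onFun] using hij)
      (fun _ => .of_discrete), Set.iUnion_of_singleton, measure_univ]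
  refine Measure.ext_of_singleton fun x => ?_
  rw [Measure.map_apply (f := ((↑) : ℕ → ℕ∞)) .of_discrete .of_discrete]
  cases x with
  | top =>
    rw [htop]
    have : ((↑) : ℕ → ℕ∞) ⁻¹' {⊤} = ∅ := by ext; simp
    simp [this]
  | coe k => rw [hfin, hcast]

lemma lintegral_comp_pointCount [IsProbabilityMeasure P] (hX : IsPoissonProcess P lam X)
    {B : Set Plane} (hB : MeasurableSet B) (hB' : volume B ≠ ∞) (f : ℕ∞ → ℝ≥0∞) :
    ∫⁻ ω, f (pointCount (X · ω) B) ∂P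
      = ∫⁻ n : ℕ, f n ∂poissonMeasure (lam * volume.real B).toNNReal := by
  rw [← lintegral_map (f := f) .of_discrete (hX.measurable_pointCount hB),
    hX.map_pointCount hB hB', lintegral_map .of_discrete .of_discrete]

lemma ae_pointCount_ne_top [IsProbabilityMeasure P] (hX : IsPoissonProcess P lam X)
    {B : Set Plane} (hB : MeasurableSet B) (hB' : volume B ≠ ∞) :
    ∀ᵐ ω ∂P, pointCount (X · ω) B ≠ ⊤ := by
  refine (ae_map_iff (hX.measurable_pointCount hB).aemeasurable (p := fun n => n ≠ ⊤)
    .of_discrete).1 ?_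
  rw [hX.map_pointCount hB hB', ae_map_iff (Measurable.of_discrete).aemeasurable .of_discrete]
  simp

lemma iIndepFun_pointCount (hX : IsPoissonProcess P lam X) {ι : Type*} [Fintype ι]
    {B : ι → Set Plane} (hB : ∀ m, MeasurableSet (B m)) (hB' : ∀ m, volume (B m) ≠ ∞)
    (hd : Pairwise (Function.onFun Disjoint B)) :
    iIndepFun (fun m ω => pointCount (X · ω) (B m)) P := by
  let e := Fintype.equivFin ι
  have h := hX.indep (Fintype.card ι) (fun k => B (e.symm k)) (fun _ => hB _) (fun _ => hB' _)
    (fun i j hij => hd (e.symm.injective.ne hij))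
  simpa using h.precomp e.injective

end IsPoissonProcess

/-! ### The generating functional of a Poisson process -/

section GeneratingFunctional

open Filter Topology Finset

open Classical in
-- Only finitely many indices fall in each set, so the partial products are constant past the last
-- of them. Without finiteness, `toNat` would send `⊤` to the wrong exponent `0`.
lemma eventually_prod_range_eq_pow {ι : Type*} [Fintype ι] (x : ℕ → Plane) (B : ι → Set Plane)
    (a : ι → ℝ≥0∞) (hfin : ∀ m, pointCount x (B m) ≠ ⊤) :
    ∀ᶠ n in atTop, ∏ i ∈ range n, ∏ m, (if x i ∈ B m then a m else 1)
      = ∏ m, a m ^ (pointCount x (B m)).toNat := by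
  have h : ∀ m, ∀ᶠ n in atTop, ∏ i ∈ range n, (if x i ∈ B m then a m else 1)
      = a m ^ (pointCount x (B m)).toNat := fun m => by
    have hf : {i | x i ∈ B m}.Finite := Set.encard_ne_top_iff.1 (hfin m)
    obtain ⟨N, hN⟩ := hf.bddAbove
    filter_upwards [eventually_gt_atTop N] with n hn
    rw [prod_ite, prod_const, prod_const_one, mul_one]
    congr 1
    have : {i | x i ∈ B m} = ((range n).filter fun i => x i ∈ B m : Finset ℕ) := by
      ext i
      simp only [Set.mem_ofPred_eq, coe_filter, mem_range]
      exact ⟨fun hi => ⟨(hN hi).trans_lt hn, hi⟩, fun hi => hi.2⟩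
    rw [pointCount, this, Set.encard_coe_eq_coe_finsetCard, ENat.toNat_natCast]
  filter_upwards [eventually_all.2 h] with n hn
  rw [Finset.prod_comm]
  exact prod_congr rfl fun m _ => hn m

open Classical in
lemma iInf_prod_range_eq_pow {ι : Type*} [Fintype ι] (x : ℕ → Plane) (B : ι → Set Plane)
    (a : ι → ℝ≥0∞) (ha : ∀ m, a m ≤ 1) (hfin : ∀ m, pointCount x (B m) ≠ ⊤) :
    ⨅ n, ∏ i ∈ range n, ∏ m, (if x i ∈ B m then a m else 1)
      = ∏ m, a m ^ (pointCount x (B m)).toNat := by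
  have hanti : Antitone fun n => ∏ i ∈ range n, ∏ m, (if x i ∈ B m then a m else 1) :=
    antitone_nat_of_succ_le fun n => by
      rw [prod_range_succ]
      refine mul_le_of_le_one_right' (prod_le_one' fun m _ => ?_)
      split_ifs
      exacts [ha m, le_rfl]
  exact tendsto_nhds_unique (tendsto_atTop_iInf hanti)
    (tendsto_const_nhds.congr' ((eventually_prod_range_eq_pow x B a hfin).mono fun _ h => h.symm))

lemma antitone_prod_range {f : ℕ → ℝ≥0∞} (hf : ∀ i, f i ≤ 1) :
    Antitone fun n => ∏ i ∈ range n, f i :=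
  antitone_nat_of_succ_le fun n => by
    rw [prod_range_succ]
    exact mul_le_of_le_one_right' (hf n)

variable {Ω : Type*} [MeasurableSpace Ω] {P : Measure Ω} {lam : ℝ} {X : ℕ → Ω → Plane}

/-- Independence of the counts factors the expectation, and each factor is the Poisson generating
function at `1 - c m`. -/
lemma IsPoissonProcess.lintegral_prod_pow [IsProbabilityMeasure P]
    (hX : IsPoissonProcess P lam X) (hlam : 0 ≤ lam) {ι : Type*} [Fintype ι]
    {B : ι → Set Plane} (hB : ∀ m, MeasurableSet (B m)) (hB' : ∀ m, volume (B m) ≠ ∞)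
    (hd : Pairwise (Function.onFun Disjoint B)) {c : ι → ℝ≥0∞} (hc : ∀ m, c m ≤ 1) :
    ∫⁻ ω, ∏ m, (1 - c m) ^ (pointCount (X · ω) (B m)).toNat ∂P
      = ENNReal.ofReal (Real.exp (-(lam * (∑ m, c m * volume (B m)).toReal))) := by
  have hi := (hX.iIndepFun_pointCount hB hB' hd).comp
    (fun m (n : ℕ∞) => (1 - c m) ^ n.toNat) (fun _ => .of_discrete)
  have hp := lintegral_prod_eq_prod_lintegral_of_indepFun univ _ hi fun m =>
    (Measurable.of_discrete (f := fun n : ℕ∞ => (1 - c m) ^ n.toNat)).comp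
      (hX.measurable_pointCount (hB m))
  simp only [Function.comp_apply] at hp
  rw [hp, ENNReal.toReal_sum fun m _ =>
    ENNReal.mul_ne_top ((hc m).trans_lt ENNReal.one_lt_top).ne (hB' m), mul_sum,
    ← sum_neg_distrib, Real.exp_sum, ENNReal.ofReal_prod_of_nonneg fun _ _ => (Real.exp_pos _).le]
  refine prod_congr rfl fun m _ => ?_
  have hct : (c m).toReal ≤ 1 := ENNReal.toReal_le_of_le_ofReal zero_le_one (by simpa using hc m)
  rw [hX.lintegral_comp_pointCount (hB m) (hB' m) (fun n => (1 - c m) ^ n.toNat)]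
  have : 1 - c m = ENNReal.ofReal (1 - (c m).toReal) := by
    rw [ENNReal.ofReal_sub _ ENNReal.toReal_nonneg, ENNReal.ofReal_one,
      ENNReal.ofReal_toReal ((hc m).trans_lt ENNReal.one_lt_top).ne]
  simp only [ENat.toNat_natCast, this]
  rw [lintegral_poissonMeasure_pow _ (by linarith), ENNReal.toReal_mul,
    Real.coe_toNNReal _ (by positivity)]
  simp only [measureReal_def]
  congr 3
  ring

lemma IsPoissonProcess.measurable_prod_range (hX : IsPoissonProcess P lam X)
    {f : Plane → ℝ≥0∞} (hf : Measurable f) (n : ℕ) :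
    Measurable fun ω => ∏ i ∈ range n, f (X i ω) :=
  Finset.measurable_fun_prod _ fun i _ => hf.comp (hX.measurable i)

/-- The infinite product over points is represented as an infimum of decreasing partial products.
For a simple function, grouping the points by level set reduces it to powers of counts. -/
lemma IsPoissonProcess.iInf_lintegral_prod_simpleFunc [IsProbabilityMeasure P]
    (hX : IsPoissonProcess P lam X) (hlam : 0 ≤ lam) (s : SimpleFunc Plane ℝ≥0∞)
    (hs : ∀ x, s x ≤ 1) (hs' : volume (Function.support s) ≠ ∞) :
    ⨅ n, ∫⁻ ω, ∏ i ∈ range n, (1 - s (X i ω)) ∂P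
      = ENNReal.ofReal (Real.exp (-(lam * (∫⁻ x, s x).toReal))) := by
  classical
  have hm : Measurable fun x => 1 - s x := measurable_const.sub s.measurable
  rw [← lintegral_iInf (fun n => hX.measurable_prod_range hm n)
    (fun m n hmn ω => antitone_prod_range (fun i => tsub_le_self) hmn) (by simp)]
  -- The value `0` contributes the factor `1`, and its level set is the only one whose area may be
  -- infinite.
  let T := s.range.erase 0
  let B : T → Set Plane := fun c => s ⁻¹' {(c : ℝ≥0∞)}
  have hB : ∀ c, MeasurableSet (B c) := fun c => s.measurableSet_fiber _
  have hB' : ∀ c, volume (B c) ≠ ∞ := fun c => measure_ne_top_of_subset (fun x hx => by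
    have : s x = c := hx
    rw [Function.mem_support, this]
    exact (mem_erase.1 c.2).1) hs'
  have hd : Pairwise (Function.onFun Disjoint B) := fun c d hcd =>
    Disjoint.preimage _ (by simpa using fun h => hcd (Subtype.ext h))
  have hc : ∀ c : T, (c : ℝ≥0∞) ≤ 1 := fun c => by
    obtain ⟨x, hx⟩ := SimpleFunc.mem_range.1 (mem_erase.1 c.2).2
    exact hx ▸ hs x
  have hprod : ∀ x, 1 - s x = ∏ c : T, (if x ∈ B c then 1 - (c : ℝ≥0∞) else 1) := fun x => by
    rw [Finset.univ_eq_attach, prod_attach T (fun c => if x ∈ s ⁻¹' {c} then 1 - c else 1)]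
    simp only [Set.mem_preimage, Set.mem_singleton_iff]
    rw [prod_ite_eq]
    split_ifs with h
    · rfl
    · have : s x = 0 := by
        by_contra h0
        exact h (mem_erase.2 ⟨h0, s.mem_range_self x⟩)
      simp [this]
  have hsum : ∫⁻ x, s x = ∑ c : T, (c : ℝ≥0∞) * volume (B c) := by
    rw [SimpleFunc.lintegral_eq_lintegral, SimpleFunc.lintegral, Finset.univ_eq_attach,
      sum_attach T (fun c => c * volume (s ⁻¹' {c}))]
    refine (sum_erase _ ?_).symm
    simp
  rw [hsum, ← hX.lintegral_prod_pow hlam hB hB' hd hc]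
  refine lintegral_congr_ae ?_
  filter_upwards [ae_all_iff.2 fun c => hX.ae_pointCount_ne_top (hB c) (hB' c)] with ω hω
  simp_rw [hprod]
  exact iInf_prod_range_eq_pow _ B _ (fun _ => tsub_le_self) hω

/-- The generating functional of a Poisson process. -/
lemma IsPoissonProcess.iInf_lintegral_prod [IsProbabilityMeasure P]
    (hX : IsPoissonProcess P lam X) (hlam : 0 ≤ lam) {q : Plane → ℝ≥0∞} (hq : Measurable q)
    (hq1 : ∀ x, q x ≤ 1) (hq' : volume (Function.support q) ≠ ∞) :
    ⨅ n, ∫⁻ ω, ∏ i ∈ range n, (1 - q (X i ω)) ∂P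
      = ENNReal.ofReal (Real.exp (-(lam * (∫⁻ x, q x).toReal))) := by
  let s := SimpleFunc.eapprox q
  have hle : ∀ k x, s k x ≤ q x := fun k x => by
    rw [← SimpleFunc.iSup_eapprox_apply hq x]
    exact le_iSup (fun k => s k x) k
  have hs' : ∀ k, volume (Function.support (s k)) ≠ ∞ := fun k => by
    refine measure_ne_top_of_subset (fun x hx => ?_) hq'
    rw [Function.mem_support] at hx ⊢
    exact fun h0 => hx (le_zero_iff.1 ((hle k x).trans h0.le))
  have hfin : ∫⁻ x, q x ≠ ∞ := by
    have : ∫⁻ x, q x ≤ ∫⁻ x, (Function.support q).indicator 1 x := lintegral_mono fun x => by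
      by_cases h : q x = 0
      · simp [h]
      · rw [Set.indicator_of_mem (by simpa using h)]
        exact hq1 x
    refine (this.trans_lt ?_).ne
    rw [lintegral_indicator_one (measurableSet_support hq)]
    exact hq'.lt_top
  have hterm : ∀ n, ∫⁻ ω, ∏ i ∈ range n, (1 - q (X i ω)) ∂P
      = ⨅ k, ∫⁻ ω, ∏ i ∈ range n, (1 - s k (X i ω)) ∂P := fun n => by
    have hanti : Antitone fun (k : ℕ) ω => ∏ i ∈ range n, (1 - s k (X i ω)) := fun k l hkl ω =>
      prod_le_prod' fun i _ => tsub_le_tsub_left (SimpleFunc.monotone_eapprox q hkl _) _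
    rw [← lintegral_iInf (fun k => hX.measurable_prod_range
      (f := fun x => 1 - s k x) (measurable_const.sub (s k).measurable) n) hanti]
    · refine lintegral_congr fun ω => ?_
      refine tendsto_nhds_unique ?_ (tendsto_atTop_iInf fun k l hkl => hanti hkl ω)
      refine ENNReal.tendsto_finsetProd_of_ne_top _ (fun i _ => ?_) (fun i _ => ?_)
      · exact ENNReal.Tendsto.sub tendsto_const_nhds (SimpleFunc.tendsto_eapprox hq _) (by simp)
      · exact (tsub_le_self.trans_lt ENNReal.one_lt_top).ne
    · refine ((lintegral_mono (g := fun _ => 1) fun ω =>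
        prod_le_one' fun i _ => tsub_le_self).trans_lt ?_).ne
      simp
  simp_rw [hterm]
  -- Both limits are decreasing, so they commute: the number of points may go to infinity first, for
  -- each simple function separately.
  rw [iInf_comm]
  simp_rw [fun k => hX.iInf_lintegral_prod_simpleFunc hlam (s k)
    (fun x => (hle k x).trans (hq1 x)) (hs' k)]
  have hmono : Monotone fun k => ∫⁻ x, s k x := fun k l hkl =>
    lintegral_mono fun x => SimpleFunc.monotone_eapprox q hkl x
  have hlim : Tendsto (fun k => ∫⁻ x, s k x) atTop (𝓝 (∫⁻ x, q x)) :=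
    lintegral_tendsto_of_tendsto_of_monotone (fun k => (s k).measurable.aemeasurable)
      (.of_forall fun x k l hkl => SimpleFunc.monotone_eapprox q hkl x)
      (.of_forall fun x => SimpleFunc.tendsto_eapprox hq x)
  refine tendsto_nhds_unique (tendsto_atTop_iInf fun k l hkl => ?_) ?_
  · refine ENNReal.ofReal_le_ofReal (Real.exp_le_exp.2 (neg_le_neg ?_))
    refine mul_le_mul_of_nonneg_left (ENNReal.toReal_mono ?_ (hmono hkl)) hlam
    exact ((lintegral_mono (hle l)).trans_lt hfin.lt_top).ne
  · refine (ENNReal.continuous_ofReal.comp Real.continuous_exp).continuousAt.tendsto.comp ?_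
    exact (((ENNReal.tendsto_toReal hfin).comp hlim).const_mul lam).neg

end GeneratingFunctional

/-! ### Campbell's formula and the second factorial moment measure -/

section MomentMeasures

/-- Counts are controlled only on sets of finite area; these form a π-system that determines the
measures compared below. -/
lemma generateFrom_measurableSet_volume_ne_top :
    MeasurableSpace.generateFrom {s : Set Plane | MeasurableSet s ∧ volume s ≠ ∞}
      = inferInstanceAs (MeasurableSpace Plane) := by
  refine le_antisymm (MeasurableSpace.generateFrom_le fun s hs => hs.1) fun s hs => ?_
  have hsU : s = ⋃ n, s ∩ spanningSets volume n := by
    rw [← Set.inter_iUnion, iUnion_spanningSets, Set.inter_univ]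
  rw [hsU]
  exact MeasurableSet.iUnion fun n => MeasurableSpace.measurableSet_generateFrom
    ⟨hs.inter (measurableSet_spanningSets _ _), measure_ne_top_of_subset Set.inter_subset_right
      (measure_spanningSets_lt_top _ _).ne⟩

lemma isPiSystem_measurableSet_volume_ne_top :
    IsPiSystem {s : Set Plane | MeasurableSet s ∧ volume s ≠ ∞} :=
  fun _ hs _ ht _ => ⟨hs.1.inter ht.1, measure_ne_top_of_subset Set.inter_subset_left hs.2⟩

/-- A multiple of the area measure is spanned by sets of finite area. -/
def finiteSpanningSetsInVolume (c : NNReal) :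
    (c • (volume : Measure Plane)).FiniteSpanningSetsIn
      {s : Set Plane | MeasurableSet s ∧ volume s ≠ ∞} where
  set n := spanningSets volume n
  set_mem n := ⟨measurableSet_spanningSets _ _, (measure_spanningSets_lt_top _ _).ne⟩
  finite n := by
    rw [Measure.smul_apply]
    exact ENNReal.mul_lt_top ENNReal.coe_lt_top (measure_spanningSets_lt_top _ _)
  spanning := iUnion_spanningSets _

namespace IsPoissonProcess

variable {Ω : Type*} [MeasurableSpace Ω] {P : Measure Ω} {lam : ℝ} {X : ℕ → Ω → Plane}

lemma measurable_comp (hX : IsPoissonProcess P lam X) {f : Plane → ℝ≥0∞} (hf : Measurable f)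
    (i : ℕ) : Measurable fun ω => f (X i ω) :=
  hf.comp (hX.measurable i)

lemma measurable_pair (hX : IsPoissonProcess P lam X) (i j : ℕ) :
    Measurable fun ω => (X i ω, X j ω) :=
  (hX.measurable i).prodMk (hX.measurable j)

variable [IsProbabilityMeasure P]

lemma coe_toNNReal_mul_volume (hlam : 0 ≤ lam) {B : Set Plane} (hB' : volume B ≠ ∞) :
    (((lam * volume.real B).toNNReal : NNReal) : ℝ≥0∞) = lam.toNNReal * volume B := by
  rw [Real.toNNReal_mul hlam, ENNReal.coe_mul]
  congr 1
  exact ENNReal.ofReal_toReal hB'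

lemma lintegral_pointCount (hX : IsPoissonProcess P lam X) (hlam : 0 ≤ lam) {B : Set Plane}
    (hB : MeasurableSet B) (hB' : volume B ≠ ∞) :
    ∫⁻ ω, (pointCount (X · ω) B : ℝ≥0∞) ∂P = lam.toNNReal * volume B := by
  rw [hX.lintegral_comp_pointCount hB hB' (fun n => (n : ℝ≥0∞)), ← coe_toNNReal_mul_volume hlam hB']
  simpa using lintegral_poissonMeasure_id _

lemma lintegral_pointCount_mul_self (hX : IsPoissonProcess P lam X) (hlam : 0 ≤ lam)
    {B : Set Plane} (hB : MeasurableSet B) (hB' : volume B ≠ ∞) :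
    ∫⁻ ω, (pointCount (X · ω) B : ℝ≥0∞) * pointCount (X · ω) B ∂P
      = (lam.toNNReal * volume B) * (lam.toNNReal * volume B) + lam.toNNReal * volume B := by
  rw [hX.lintegral_comp_pointCount hB hB' (fun n => (n : ℝ≥0∞) * n),
    ← coe_toNNReal_mul_volume hlam hB']
  simpa using lintegral_poissonMeasure_mul_self _

lemma lintegral_pointCount_mul_of_disjoint (hX : IsPoissonProcess P lam X) (hlam : 0 ≤ lam)
    {B C : Set Plane} (hB : MeasurableSet B) (hB' : volume B ≠ ∞) (hC : MeasurableSet C)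
    (hC' : volume C ≠ ∞) (hd : Disjoint B C) :
    ∫⁻ ω, (pointCount (X · ω) B : ℝ≥0∞) * pointCount (X · ω) C ∂P
      = (lam.toNNReal * volume B) * (lam.toNNReal * volume C) := by
  have hi := hX.iIndepFun_pointCount (B := fun b : Bool => if b then B else C)
    (by rintro (_ | _) <;> simpa) (by rintro (_ | _) <;> simpa)
    (by rintro (_ | _) (_ | _) h <;> simp_all [Function.onFun, hd.symm])
  have hBC := (hi.indepFun (i := true) (j := false) (by simp)).comp
    (φ := fun n : ℕ∞ => (n : ℝ≥0∞)) (ψ := fun n : ℕ∞ => (n : ℝ≥0∞)) .of_discrete .of_discrete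
  simp only [if_true, Bool.false_eq_true, if_false] at hBC
  rw [← hX.lintegral_pointCount hlam hB hB', ← hX.lintegral_pointCount hlam hC hC']
  exact lintegral_mul_eq_lintegral_mul_lintegral_of_indepFun
    (Measurable.of_discrete.comp (hX.measurable_pointCount hB))
    (Measurable.of_discrete.comp (hX.measurable_pointCount hC)) hBC

lemma pointCount_union_of_disjoint (x : ℕ → Plane) {B C : Set Plane} (hd : Disjoint B C) :
    (pointCount x (B ∪ C) : ℝ≥0∞) = pointCount x B + pointCount x C := by
  rw [← ENat.toENNReal_add]
  congr 1
  exact Set.encard_union_eq (hd.preimage x)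

/-- Split both sets along their intersection: disjoint pieces are independent, and only the common
piece contributes a second moment, whose excess over the squared mean is the last term. -/
lemma lintegral_pointCount_mul (hX : IsPoissonProcess P lam X) (hlam : 0 ≤ lam)
    {B C : Set Plane} (hB : MeasurableSet B) (hB' : volume B ≠ ∞) (hC : MeasurableSet C)
    (hC' : volume C ≠ ∞) :
    ∫⁻ ω, (pointCount (X · ω) B : ℝ≥0∞) * pointCount (X · ω) C ∂P
      = (lam.toNNReal * volume B) * (lam.toNNReal * volume C)
        + lam.toNNReal * volume (B ∩ C) := by
  have hBd : Disjoint (B \ C) (B ∩ C) := Set.disjoint_sdiff_inter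
  have hCd : Disjoint (C \ B) (B ∩ C) := by
    rw [Set.inter_comm]; exact Set.disjoint_sdiff_inter
  have hBC : Disjoint (B \ C) (C \ B) := disjoint_sdiff_sdiff
  have eB : B = (B \ C) ∪ (B ∩ C) := (Set.sdiff_union_inter B C).symm
  have eC : C = (C \ B) ∪ (B ∩ C) := by rw [Set.inter_comm, Set.sdiff_union_inter]
  have mB := hB.diff hC
  have mC := hC.diff hB
  have mI := hB.inter hC
  have fB : volume (B \ C) ≠ ∞ := measure_ne_top_of_subset Set.sdiff_subset hB'
  have fC : volume (C \ B) ≠ ∞ := measure_ne_top_of_subset Set.sdiff_subset hC'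
  have fI : volume (B ∩ C) ≠ ∞ := measure_ne_top_of_subset Set.inter_subset_left hB'
  have hm : ∀ {S : Set Plane}, MeasurableSet S →
      Measurable fun ω => (pointCount (X · ω) S : ℝ≥0∞) := fun hS =>
    Measurable.of_discrete.comp (hX.measurable_pointCount hS)
  have vB : volume B = volume (B \ C) + volume (B ∩ C) := (measure_sdiff_add_inter B hC).symm
  have vC : volume C = volume (C \ B) + volume (B ∩ C) := by
    rw [Set.inter_comm, measure_sdiff_add_inter C hB]
  have hsplit : ∀ ω, (pointCount (X · ω) B : ℝ≥0∞) * pointCount (X · ω) C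
      = (pointCount (X · ω) (B \ C) : ℝ≥0∞) * pointCount (X · ω) (C \ B)
        + (pointCount (X · ω) (B \ C) : ℝ≥0∞) * pointCount (X · ω) (B ∩ C)
        + (pointCount (X · ω) (C \ B) : ℝ≥0∞) * pointCount (X · ω) (B ∩ C)
        + (pointCount (X · ω) (B ∩ C) : ℝ≥0∞) * pointCount (X · ω) (B ∩ C) := fun ω => by
    have h1 := pointCount_union_of_disjoint (X · ω) hBd
    have h2 := pointCount_union_of_disjoint (X · ω) hCd
    rw [← eB] at h1
    rw [← eC] at h2
    rw [h1, h2]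
    ring
  simp_rw [hsplit]
  rw [lintegral_add_left (((hm mB).fun_mul (hm mC)).fun_add ((hm mB).fun_mul (hm mI)) |>.fun_add
      ((hm mC).fun_mul (hm mI))),
    lintegral_add_left (((hm mB).fun_mul (hm mC)).fun_add ((hm mB).fun_mul (hm mI))),
    lintegral_add_left ((hm mB).fun_mul (hm mC)),
    hX.lintegral_pointCount_mul_of_disjoint hlam mB fB mC fC hBC,
    hX.lintegral_pointCount_mul_of_disjoint hlam mB fB mI fI hBd,
    hX.lintegral_pointCount_mul_of_disjoint hlam mC fC mI fI hCd,
    hX.lintegral_pointCount_mul_self hlam mI fI, vB, vC]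
  ring

lemma sum_map_eq (hX : IsPoissonProcess P lam X) (hlam : 0 ≤ lam) :
    Measure.sum (fun i => P.map (X i)) = lam.toNNReal • (volume : Measure Plane) := by
  refine ((finiteSpanningSetsInVolume lam.toNNReal).ext
    generateFrom_measurableSet_volume_ne_top.symm isPiSystem_measurableSet_volume_ne_top
    fun s hs => ?_).symm
  rw [Measure.smul_apply, Measure.sum_apply _ hs.1]
  refine (hX.lintegral_pointCount hlam hs.1 hs.2).symm.trans ?_
  simp_rw [toENNReal_pointCount]
  rw [lintegral_tsum fun i => (hX.measurable_comp (measurable_one.indicator hs.1) i).aemeasurable]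
  refine tsum_congr fun i => ?_
  rw [← lintegral_map (measurable_one.indicator hs.1) (hX.measurable i),
    lintegral_indicator_one hs.1]

/-- Campbell's formula. -/
lemma lintegral_tsum_comp (hX : IsPoissonProcess P lam X) (hlam : 0 ≤ lam) {f : Plane → ℝ≥0∞}
    (hf : Measurable f) :
    ∫⁻ ω, ∑' i, f (X i ω) ∂P = lam.toNNReal * ∫⁻ x, f x := by
  rw [lintegral_tsum fun i => (hX.measurable_comp hf i).aemeasurable]
  simp_rw [← fun i => lintegral_map (μ := P) hf (hX.measurable i)]
  rw [← lintegral_sum_measure, hX.sum_map_eq hlam, lintegral_smul_measure]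
  rfl

lemma sum_map_pair_eq (hX : IsPoissonProcess P lam X) (hlam : 0 ≤ lam) :
    Measure.sum (fun i => Measure.sum fun j =>
        if j = i then 0 else P.map fun ω => (X i ω, X j ω))
      = (lam.toNNReal • (volume : Measure Plane)).prod (lam.toNNReal • volume) := by
  refine (Measure.prod_eq_generateFrom generateFrom_measurableSet_volume_ne_top
    generateFrom_measurableSet_volume_ne_top isPiSystem_measurableSet_volume_ne_top
    isPiSystem_measurableSet_volume_ne_top (finiteSpanningSetsInVolume _)
    (finiteSpanningSetsInVolume _) fun s hs t ht => ?_).symm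
  have hst := hs.1.prod ht.1
  have hI : (lam.toNNReal : ℝ≥0∞) * volume (s ∩ t) ≠ ∞ :=
    ENNReal.mul_ne_top ENNReal.coe_ne_top (measure_ne_top_of_subset Set.inter_subset_left hs.2)
  -- Adding the finite diagonal contribution to both sides completes the sum to all pairs, which is
  -- the mean of a product of two counts.
  refine (ENNReal.add_left_inj hI).1 ?_
  refine Eq.trans ?_ (hX.lintegral_pointCount_mul hlam hs.1 hs.2 ht.1 ht.2)
  rw [← hX.lintegral_pointCount hlam (hs.1.inter ht.1)
    (measure_ne_top_of_subset Set.inter_subset_left hs.2)]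
  have hm : ∀ i j, Measurable fun ω => s.indicator (1 : Plane → ℝ≥0∞) (X i ω)
      * t.indicator (1 : Plane → ℝ≥0∞) (X j ω) := fun i j =>
    ((measurable_one.indicator hs.1).comp (hX.measurable i)).mul
      ((measurable_one.indicator ht.1).comp (hX.measurable j))
  have hp : ∀ i j, P.map (fun ω => (X i ω, X j ω)) (s ×ˢ t)
      = ∫⁻ ω, s.indicator 1 (X i ω) * t.indicator 1 (X j ω) ∂P := fun i j => by
    rw [← lintegral_indicator_one hst, lintegral_map (measurable_one.indicator hst)
      (hX.measurable_pair i j)]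
    refine lintegral_congr fun ω => ?_
    by_cases h1 : X i ω ∈ s <;> by_cases h2 : X j ω ∈ t <;> simp [h1, h2]
  simp_rw [toENNReal_pointCount, ← ENNReal.tsum_mul_right, ← ENNReal.tsum_mul_left]
  rw [lintegral_tsum fun i => (Measurable.tsum fun j => hm i j).aemeasurable,
    lintegral_tsum fun i => (hX.measurable_comp (measurable_one.indicator
      (hs.1.inter ht.1)) i).aemeasurable,
    Measure.sum_apply _ hst, ← ENNReal.tsum_add]
  refine tsum_congr fun i => ?_
  rw [Measure.sum_apply _ hst, lintegral_tsum fun j => (hm i j).aemeasurable, add_comm]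
  conv_rhs => rw [ENNReal.tsum_eq_add_tsum_ite i]
  congr 1
  · refine lintegral_congr fun ω => ?_
    by_cases h1 : X i ω ∈ s <;> by_cases h2 : X i ω ∈ t <;> simp [h1, h2]
  · refine tsum_congr fun j => ?_
    split_ifs
    · rfl
    · exact hp i j

/-- The second factorial moment measure of a Poisson process. -/
lemma lintegral_tsum_tsum_comp (hX : IsPoissonProcess P lam X) (hlam : 0 ≤ lam)
    {f : Plane × Plane → ℝ≥0∞} (hf : Measurable f) :
    ∫⁻ ω, ∑' i, ∑' j, (if j = i then 0 else f (X i ω, X j ω)) ∂P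
      = lam.toNNReal * (lam.toNNReal * ∫⁻ x, ∫⁻ y, f (x, y)) := by
  have hm : ∀ i j, Measurable fun ω => if j = i then 0 else f (X i ω, X j ω) := fun i j => by
    split_ifs
    · exact measurable_const
    · exact hf.comp (hX.measurable_pair i j)
  have h := congrArg (fun μ => ∫⁻ p, f p ∂μ) (hX.sum_map_pair_eq hlam)
  simp only [lintegral_sum_measure] at h
  rw [lintegral_prod _ hf.aemeasurable] at h
  simp only [lintegral_smul_measure] at h
  rw [lintegral_tsum fun i => (Measurable.tsum fun j => hm i j).aemeasurable]
  simp_rw [fun i => lintegral_tsum fun j => (hm i j).aemeasurable (μ := P)]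
  refine Eq.trans ?_ (h.trans ?_)
  · refine tsum_congr fun i => tsum_congr fun j => ?_
    split_ifs
    · simp
    · rw [lintegral_map hf (hX.measurable_pair i j)]
  · simp only [ENNReal.smul_def, smul_eq_mul]
    rw [lintegral_const_mul _ hf.lintegral_prod_right']

end IsPoissonProcess

end MomentMeasures

/-! ### Void probabilities of the marked process -/

section MarkedProcess

variable {Ω : Type*} [MeasurableSpace Ω] {P : Measure Ω} {lamS lamPT Rp : ℝ}
  {su tx rx : ℕ → Ω → Plane}

lemma isProbabilityMeasure_uniformDisk (a : Plane) {r : ℝ} (hr : 0 < r) :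
    IsProbabilityMeasure (uniformDisk a r) :=
  cond_isProbabilityMeasure_of_finite (Metric.measure_closedBall_pos volume a hr).ne'
    measure_closedBall_lt_top.ne

namespace IsNetwork

lemma measurable_offset (h : IsNetwork P lamS lamPT Rp su tx rx) (i : ℕ) :
    Measurable fun ω => rx i ω - tx i ω :=
  (h.measurable_rx i).sub (h.transmitters.measurable i)

lemma map_marked [IsProbabilityMeasure P] (h : IsNetwork P lamS lamPT Rp su tx rx) :
    P.map (fun ω => ((fun i => tx i ω), fun i => rx i ω - tx i ω))
      = (P.map fun ω i => tx i ω).prod (Measure.infinitePi fun _ : ℕ => uniformDisk 0 Rp) := by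
  have ht : Measurable fun ω i => tx i ω := measurable_pi_iff.2 h.transmitters.measurable
  have hz : Measurable fun ω i => rx i ω - tx i ω := measurable_pi_iff.2 h.measurable_offset
  rw [(indepFun_iff_map_prod_eq_prod_map_map ht.aemeasurable hz.aemeasurable).1 h.indep_tx_rx,
    h.iIndep_rx.map_fun_eq_infinitePi_map h.measurable_offset]
  simp_rw [h.uniform_rx]

open Finset in
-- Given the transmitters, the offsets are independent, so avoiding `S` factors into one avoidance
-- probability for each transmitter.
lemma measure_forall_lt_notMem [IsProbabilityMeasure P] (h : IsNetwork P lamS lamPT Rp su tx rx)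
    (hRp : 0 < Rp) {S : Set (Plane × Plane)} (hS : MeasurableSet S) (n : ℕ) :
    P {ω | ∀ i ∈ range n, (tx i ω, rx i ω - tx i ω) ∉ S}
      = ∫⁻ ω, ∏ i ∈ range n, (1 - uniformDisk 0 Rp (Prod.mk (tx i ω) ⁻¹' S)) ∂P := by
  have := isProbabilityMeasure_uniformDisk 0 hRp
  have ht : Measurable fun ω i => tx i ω := measurable_pi_iff.2 h.transmitters.measurable
  have hz : Measurable fun ω i => rx i ω - tx i ω := measurable_pi_iff.2 h.measurable_offset
  have hT : MeasurableSet {p : (ℕ → Plane) × (ℕ → Plane) | ∀ i ∈ range n, (p.1 i, p.2 i) ∉ S} := by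
    have : {p : (ℕ → Plane) × (ℕ → Plane) | ∀ i ∈ range n, (p.1 i, p.2 i) ∉ S}
        = ⋂ i ∈ range n, (fun p : (ℕ → Plane) × (ℕ → Plane) => (p.1 i, p.2 i)) ⁻¹' Sᶜ := by
      ext; simp
    rw [this]
    refine Finset.measurableSet_biInter _ fun i _ => ?_
    exact (show Measurable fun p : (ℕ → Plane) × (ℕ → Plane) => (p.1 i, p.2 i) by
      fun_prop) hS.compl
  have hf : Measurable fun x : Plane => 1 - uniformDisk 0 Rp (Prod.mk x ⁻¹' S) :=
    measurable_const.sub (measurable_measure_prodMk_left hS)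
  have h1 := congrArg (fun μ => μ {p | ∀ i ∈ range n, (p.1 i, p.2 i) ∉ S}) h.map_marked
  rw [Measure.map_apply (ht.prodMk hz) hT, Measure.prod_apply hT,
    lintegral_map (measurable_measure_prodMk_left hT) ht] at h1
  refine h1.trans (lintegral_congr fun ω => ?_)
  have h2 : Prod.mk (fun i => tx i ω) ⁻¹'
        {p : (ℕ → Plane) × (ℕ → Plane) | ∀ i ∈ range n, (p.1 i, p.2 i) ∉ S}
      = Set.pi (range n) fun i => (Prod.mk (tx i ω) ⁻¹' S)ᶜ := by
    ext; simp
  rw [h2, Measure.infinitePi_pi _ fun i _ => (measurable_prodMk_left hS).compl]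
  exact prod_congr rfl fun i _ => prob_compl_eq_one_sub (measurable_prodMk_left hS)

/-- The void probabilities of the Poisson process of transmitters marked with the offsets of
their receivers. -/
lemma measure_forall_notMem [IsProbabilityMeasure P] (h : IsNetwork P lamS lamPT Rp su tx rx)
    (hlam : 0 ≤ lamPT) (hRp : 0 < Rp) {S : Set (Plane × Plane)} (hS : MeasurableSet S)
    (hfin : volume (Function.support fun x => uniformDisk 0 Rp (Prod.mk x ⁻¹' S)) ≠ ∞) :
    P {ω | ∀ i, (tx i ω, rx i ω - tx i ω) ∉ S}
      = ENNReal.ofReal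
        (Real.exp (-(lamPT * ((volume.prod (uniformDisk 0 Rp)) S).toReal))) := by
  have := isProbabilityMeasure_uniformDisk 0 hRp
  rw [Measure.prod_apply hS, ← h.transmitters.iInf_lintegral_prod hlam
    (measurable_measure_prodMk_left hS) (fun _ => prob_le_one) hfin]
  simp_rw [← h.measure_forall_lt_notMem hRp hS]
  have hI : {ω | ∀ i, (tx i ω, rx i ω - tx i ω) ∉ S}
      = ⋂ n, {ω | ∀ i ∈ Finset.range n, (tx i ω, rx i ω - tx i ω) ∉ S} := by
    ext ω
    simp only [Set.mem_ofPred_eq, Set.mem_iInter, Finset.mem_range]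
    exact ⟨fun hω n i _ => hω i, fun hω i => hω (i + 1) i i.lt_succ_self⟩
  rw [hI]
  refine Antitone.measure_iInter (fun m n hmn ω hω i hi => ?_) (fun n => ?_)
    ⟨0, measure_ne_top _ _⟩
  · exact hω i (Finset.range_mono hmn hi)
  · have : {ω | ∀ i ∈ Finset.range n, (tx i ω, rx i ω - tx i ω) ∉ S}
        = ⋂ i ∈ Finset.range n, (fun ω => (tx i ω, rx i ω - tx i ω)) ⁻¹' Sᶜ := by
      ext; simp
    rw [this]
    exact (Finset.measurableSet_biInter _ fun i _ =>
      ((h.transmitters.measurable i).prodMk (h.measurable_offset i)) hS.compl).nullMeasurableSet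

end IsNetwork

end MarkedProcess

/-! ### Isometries and polar coordinates in the plane -/

section PlaneGeometry

/-- Two pairs of points at the same distance are related by a measure preserving isometry. -/
lemma exists_isometryEquiv {x y x' y' : Plane} (h : dist x y = dist x' y') :
    ∃ e : Plane ≃ᵢ Plane, MeasurePreserving e volume volume ∧ e x = x' ∧ e y = y' := by
  have hn : ‖y - x‖ = ‖y' - x'‖ := by rw [← dist_eq_norm, ← dist_eq_norm, dist_comm, h, dist_comm]
  -- Two vectors of equal norm are exchanged by the reflection in the orthogonal complement of their
  -- difference.
  let L : Plane ≃ₗᵢ[ℝ] Plane := (ℝ ∙ ((y - x) - (y' - x')))ᗮ.reflection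
  have hL : L (y - x) = y' - x' := Submodule.reflection_sub hn
  refine ⟨(IsometryEquiv.subRight x).trans (L.toIsometryEquiv.trans (IsometryEquiv.addRight x')),
    ?_, ?_, ?_⟩
  · exact ((measurePreserving_add_right volume x').comp L.measurePreserving).comp
      (measurePreserving_sub_right volume x)
  · simp
  · simp [hL]

lemma measureReal_preimage_isometryEquiv {e : Plane ≃ᵢ Plane}
    (he : MeasurePreserving e volume volume) (s : Set Plane) :
    volume.real (e ⁻¹' s) = volume.real s :=
  congrArg ENNReal.toReal (he.measure_preimage_emb e.toHomeomorph.measurableEmbedding s)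

lemma preimage_closedBall_isometryEquiv (e : Plane ≃ᵢ Plane) (x : Plane) (r : ℝ) :
    e ⁻¹' Metric.closedBall (e x) r = Metric.closedBall x r := by
  rw [IsometryEquiv.preimage_closedBall, e.symm_apply_apply]

lemma dist_origin_left {t : ℝ} (ht : 0 ≤ t) : dist (!₂[0, 0] : Plane) !₂[t, 0] = t := by
  rw [EuclideanSpace.dist_eq]
  simp [Real.dist_eq, Real.sqrt_sq ht]

lemma dist_centered {t : ℝ} (ht : 0 ≤ t) :
    dist (!₂[-t / 2, 0] : Plane) !₂[t / 2, 0] = t := by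
  rw [EuclideanSpace.dist_eq]
  simp only [Fin.sum_univ_two, Real.dist_eq]
  simp only [Matrix.cons_val_zero, Matrix.cons_val_one, sub_self, abs_zero,
    sq_abs]
  rw [show -t / 2 - t / 2 = -t by ring]
  simp [Real.sqrt_sq ht]

lemma volumeReal_closedBall (x : Plane) {r : ℝ} (hr : 0 ≤ r) :
    volume.real (Metric.closedBall x r) = Real.pi * r ^ 2 := by
  rw [measureReal_def, EuclideanSpace.volume_closedBall_fin_two, ENNReal.toReal_mul,
    ENNReal.toReal_pow, ENNReal.toReal_ofReal hr, ENNReal.toReal_ofReal Real.pi_pos.le, mul_comm]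

lemma SI_dist (x y : Plane) (r₁ r₂ : ℝ) :
    SI (dist x y) r₁ r₂ = volume.real (Metric.closedBall x r₁ ∩ Metric.closedBall y r₂) := by
  obtain ⟨e, he, hx, hy⟩ := exists_isometryEquiv (x := x) (y := y)
    (x' := !₂[0, 0]) (y' := !₂[dist x y, 0]) (dist_origin_left dist_nonneg).symm
  rw [SI, ← measureReal_preimage_isometryEquiv he, ← hy, ← hx, Set.preimage_inter,
    preimage_closedBall_isometryEquiv, preimage_closedBall_isometryEquiv]

lemma volumeReal_union_closedBall (x y : Plane) {r : ℝ} (hr : 0 ≤ r) :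
    volume.real (Metric.closedBall x r ∪ Metric.closedBall y r)
      = 2 * (Real.pi * r ^ 2) - SI (dist x y) r r := by
  have h := measureReal_union_add_inter (μ := volume) (s := Metric.closedBall x r)
    (t := Metric.closedBall y r) Metric.isClosed_closedBall.measurableSet
    measure_closedBall_lt_top.ne measure_closedBall_lt_top.ne
  rw [volumeReal_closedBall x hr, volumeReal_closedBall y hr, ← SI_dist] at h
  linarith

/-- Radial integration; the factor `2 * π` is the dimension times the area of the unit disk. -/
lemma setIntegral_closedBall_dist (f : ℝ → ℝ) (x : Plane) {R : ℝ} (hR : 0 ≤ R) :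
    ∫ z in Metric.closedBall x R, f (dist x z) = 2 * Real.pi * ∫ t in (0 : ℝ)..R, t * f t := by
  have h1 : ∫ z in Metric.closedBall x R, f (dist x z)
      = ∫ z, (Set.Iic R).indicator f ‖z - x‖ := by
    rw [← integral_indicator Metric.isClosed_closedBall.measurableSet]
    refine integral_congr_ae (.of_forall fun z => ?_)
    by_cases hz : dist z x ≤ R
    · simp only
      rw [Set.indicator_of_mem (Metric.mem_closedBall.2 hz),
        Set.indicator_of_mem (by rwa [Set.mem_Iic, ← dist_eq_norm]), ← dist_eq_norm, dist_comm]
    · simp only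
      rw [Set.indicator_of_notMem (by rwa [Metric.mem_closedBall]),
        Set.indicator_of_notMem (by rwa [Set.mem_Iic, ← dist_eq_norm])]
  have hball : volume.real (Metric.ball (0 : Plane) 1) = Real.pi := by
    rw [measureReal_def, EuclideanSpace.volume_ball_fin_two]
    simp [Real.pi_pos.le]
  rw [h1, integral_sub_right_eq_self (fun z => (Set.Iic R).indicator f ‖z‖) x,
    integral_fun_norm_addHaar, hball, finrank_euclideanSpace_fin]
  have h2 : ∀ y : ℝ, y ^ (2 - 1) • (Set.Iic R).indicator f y
      = (Set.Iic R).indicator (fun t => t * f t) y := fun y => by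
    by_cases hy : y ∈ Set.Iic R <;> simp [hy]
  simp_rw [h2]
  rw [setIntegral_indicator measurableSet_Iic, Set.Ioi_inter_Iic,
    intervalIntegral.integral_of_le hR, nsmul_eq_mul, smul_eq_mul]
  push_cast
  ring

/-- The change of variables for `polarCoord`, carried over by the volume preserving identification
of `ℝ × ℝ` with `Plane`. -/
lemma setIntegral_polarPoint (f : Plane → ℝ) {A : Set Plane} (hA : MeasurableSet A) :
    ∫ p in {p : ℝ × ℝ | 0 < p.1 ∧ p.2 ∈ Set.Ioo (-Real.pi) Real.pi ∧ polarPoint p.1 p.2 ∈ A},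
      f (polarPoint p.1 p.2) * p.1 = ∫ x in A, f x := by
  let e : ℝ × ℝ ≃ᵐ Plane := MeasurableEquiv.finTwoArrow.symm.trans (MeasurableEquiv.toLp 2 _)
  have he : MeasurePreserving e volume volume :=
    (PiLp.volume_preserving_toLp (Fin 2)).comp ((volume_preserving_finTwoArrow ℝ).symm _)
  have hpolar : ∀ p : ℝ × ℝ, e (polarCoord.symm p) = polarPoint p.1 p.2 := fun p => by
    ext i
    fin_cases i <;> rfl
  have hm : Measurable fun p : ℝ × ℝ => polarPoint p.1 p.2 := by
    simp_rw [← hpolar]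
    exact e.measurable.comp continuous_polarCoord_symm.measurable
  rw [← integral_indicator hA, ← he.integral_comp e.measurableEmbedding,
    ← integral_comp_polarCoord_symm]
  have h : ∀ p : ℝ × ℝ, p.1 • A.indicator f (e (polarCoord.symm p))
      = ((fun p : ℝ × ℝ => polarPoint p.1 p.2) ⁻¹' A).indicator
        (fun p => f (polarPoint p.1 p.2) * p.1) p := fun p => by
    rw [hpolar]
    by_cases hp : polarPoint p.1 p.2 ∈ A
    · rw [Set.indicator_of_mem hp, Set.indicator_of_mem (by exact hp), smul_eq_mul, mul_comm]
    · rw [Set.indicator_of_notMem hp, Set.indicator_of_notMem (by exact hp), smul_zero]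
  simp_rw [h]
  rw [setIntegral_indicator (hm hA)]
  congr 2
  ext p
  simp [polarCoord, and_assoc]

end PlaneGeometry

/-! ### Measure of the forbidden marks -/

section Coverage

variable {Rp : ℝ} {A D : Set Plane}

/-- The pairs of a transmitter and an offset of its receiver for which the transmitter lies in `A`
or the receiver in `D`. -/
def coveredMarks (A D : Set Plane) : Set (Plane × Plane) :=
  {p | p.1 ∈ A ∨ p.1 + p.2 ∈ D}

/-- The mean number, per unit density, of transmitters that lie in `A` or whose receiver lies
in `D`. -/
def coverage (Rp : ℝ) (A D : Set Plane) : ℝ :=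
  (volume.prod (uniformDisk 0 Rp)).real (coveredMarks A D)

/-- The mean number, per unit density, of transmitters in `A` with a receiver in `D`. -/
def overlap (Rp : ℝ) (A D : Set Plane) : ℝ :=
  ∫ x in A, volume.real (Metric.closedBall x Rp ∩ D) / (Real.pi * Rp ^ 2)

lemma measurableSet_add_mem (hD : MeasurableSet D) :
    MeasurableSet {p : Plane × Plane | p.1 + p.2 ∈ D} :=
  (measurable_fst.add measurable_snd) hD

lemma measurableSet_fst_mem (hA : MeasurableSet A) :
    MeasurableSet {p : Plane × Plane | p.1 ∈ A} :=
  measurable_fst hA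

lemma measurableSet_coveredMarks (hA : MeasurableSet A) (hD : MeasurableSet D) :
    MeasurableSet (coveredMarks A D) :=
  (measurableSet_fst_mem hA).union (measurableSet_add_mem hD)

lemma uniformDisk_preimage_add (hRp : 0 < Rp) (D : Set Plane) (x : Plane) :
    (uniformDisk 0 Rp).real {z | x + z ∈ D}
      = volume.real (Metric.closedBall x Rp ∩ D) / (Real.pi * Rp ^ 2) := by
  have h : Metric.closedBall (0 : Plane) Rp ∩ {z | x + z ∈ D}
      = (fun z => x + z) ⁻¹' (Metric.closedBall x Rp ∩ D) := by
    ext z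
    simp
  rw [measureReal_def, uniformDisk, cond_apply Metric.isClosed_closedBall.measurableSet, h,
    measure_preimage_add, ENNReal.toReal_mul, ENNReal.toReal_inv, ← measureReal_def,
    ← measureReal_def, volumeReal_closedBall 0 hRp.le, div_eq_inv_mul]

lemma measure_fst_mem (hRp : 0 < Rp) :
    volume.prod (uniformDisk 0 Rp) {p : Plane × Plane | p.1 ∈ A} = volume A := by
  have := isProbabilityMeasure_uniformDisk 0 hRp
  have h : {p : Plane × Plane | p.1 ∈ A} = A ×ˢ Set.univ := by ext; simp
  rw [h, Measure.prod_prod, measure_univ, mul_one]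

/-- Integrate over the transmitter first: for every fixed offset the section is a translate of `D`.
Thus receivers have the same intensity as transmitters. -/
lemma measure_add_mem (hRp : 0 < Rp) (hD : MeasurableSet D) :
    volume.prod (uniformDisk 0 Rp) {p : Plane × Plane | p.1 + p.2 ∈ D} = volume D := by
  have := isProbabilityMeasure_uniformDisk 0 hRp
  rw [Measure.prod_apply_symm (measurableSet_add_mem hD)]
  have h : ∀ z : Plane, volume ((fun x => (x, z)) ⁻¹' {p : Plane × Plane | p.1 + p.2 ∈ D})
      = volume D := fun z => measure_preimage_add_right volume z D
  simp_rw [h]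
  simp

lemma measureReal_fst_mem_inter_add_mem (hRp : 0 < Rp) (hA : MeasurableSet A)
    (hD : MeasurableSet D) :
    (volume.prod (uniformDisk 0 Rp)).real
      ({p : Plane × Plane | p.1 ∈ A} ∩ {p | p.1 + p.2 ∈ D}) = overlap Rp A D := by
  have := isProbabilityMeasure_uniformDisk 0 hRp
  rw [measureReal_def, Measure.prod_apply ((measurableSet_fst_mem hA).inter
    (measurableSet_add_mem hD)), overlap]
  simp_rw [← uniformDisk_preimage_add hRp D, measureReal_def]
  have hm : Measurable fun x => uniformDisk 0 Rp {z | x + z ∈ D} :=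
    measurable_measure_prodMk_left (measurableSet_add_mem hD)
  rw [integral_toReal hm.aemeasurable (.of_forall fun x => measure_lt_top _ _), ← lintegral_indicator hA]
  congr 1
  refine lintegral_congr fun x => ?_
  by_cases hx : x ∈ A
  · rw [Set.indicator_of_mem hx]
    congr 1
    ext z
    simp [hx]
  · rw [Set.indicator_of_notMem hx]
    have : Prod.mk x ⁻¹' ({p : Plane × Plane | p.1 ∈ A} ∩ {p | p.1 + p.2 ∈ D}) = ∅ := by
      ext z
      simp [hx]
    rw [this, measure_empty]

lemma measure_coveredMarks_ne_top (hRp : 0 < Rp) (hA' : volume A ≠ ∞) (hD : MeasurableSet D)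
    (hD' : volume D ≠ ∞) : volume.prod (uniformDisk 0 Rp) (coveredMarks A D) ≠ ∞ := by
  refine ((measure_union_le {p : Plane × Plane | p.1 ∈ A} {p | p.1 + p.2 ∈ D}).trans_lt ?_).ne
  rw [measure_fst_mem hRp, measure_add_mem hRp hD]
  exact ENNReal.add_lt_top.2 ⟨hA'.lt_top, hD'.lt_top⟩

lemma coverage_eq (hRp : 0 < Rp) (hA : MeasurableSet A) (hA' : volume A ≠ ∞)
    (hD : MeasurableSet D) (hD' : volume D ≠ ∞) :
    coverage Rp A D = volume.real A + volume.real D - overlap Rp A D := by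
  have h := measureReal_union_add_inter (μ := volume.prod (uniformDisk 0 Rp))
    (s := {p : Plane × Plane | p.1 ∈ A}) (measurableSet_add_mem hD)
    (by rwa [measure_fst_mem hRp]) (by rwa [measure_add_mem hRp hD])
  rw [measureReal_fst_mem_inter_add_mem hRp hA hD] at h
  simp only [measureReal_def] at h
  rw [measure_fst_mem hRp, measure_add_mem hRp hD] at h
  rw [coverage, measureReal_def, measureReal_def, measureReal_def, ← h]
  exact (add_sub_cancel_right _ _).symm

/-- Disks of radius `Rp` and areas are both preserved, so the overlap of disk configurations depends
only on their relative position. -/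
lemma overlap_preimage_isometryEquiv {e : Plane ≃ᵢ Plane}
    (he : MeasurePreserving e volume volume) (A D : Set Plane) :
    overlap Rp (e ⁻¹' A) (e ⁻¹' D) = overlap Rp A D := by
  rw [overlap, overlap, ← he.setIntegral_preimage_emb e.toHomeomorph.measurableEmbedding _ A]
  refine integral_congr_ae (.of_forall fun x => ?_)
  simp only
  rw [← measureReal_preimage_isometryEquiv he (Metric.closedBall (e x) Rp ∩ D),
    Set.preimage_inter, preimage_closedBall_isometryEquiv]

/-- A transmitter outside `A` and farther than `Rp` from `D` cannot contribute. This supplies the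
finiteness hypothesis of the generating functional. -/
lemma volume_support_uniformDisk_ne_top (hA : Bornology.IsBounded A)
    (hD : Bornology.IsBounded D) :
    volume (Function.support fun x => uniformDisk 0 Rp (Prod.mk x ⁻¹' coveredMarks A D)) ≠ ∞ := by
  obtain ⟨a, ha⟩ := hA.subset_closedBall 0
  obtain ⟨d, hd⟩ := hD.subset_closedBall 0
  refine measure_ne_top_of_subset (s := Metric.closedBall (0 : Plane) (max a (d + Rp))) (fun x hx => ?_)
    (measure_closedBall_lt_top (μ := volume)).ne
  rw [Function.mem_support, uniformDisk, cond_apply Metric.isClosed_closedBall.measurableSet] at hx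
  obtain ⟨z, hz, hzx⟩ := nonempty_of_measure_ne_zero (right_ne_zero_of_mul hx)
  rw [mem_closedBall_zero_iff] at hz ⊢
  rcases hzx with h | h
  · exact (mem_closedBall_zero_iff.1 (ha h)).trans (le_max_left _ _)
  · have h1 := mem_closedBall_zero_iff.1 (hd h)
    have h2 : ‖x‖ ≤ ‖x + z‖ + ‖z‖ := by simpa using norm_sub_le (x + z) z
    exact (h2.trans (add_le_add h1 hz)).trans (le_max_right _ _)

end Coverage

/-! ### The exponent of `g` as a difference of coverages -/

section OpportunityGeometry

variable {rI RI Rp : ℝ}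

/-- The locations within distance `r` of `x` or of `y`. -/
def twoDisks (r : ℝ) (x y : Plane) : Set Plane :=
  Metric.closedBall x r ∪ Metric.closedBall y r

lemma measurableSet_twoDisks (r : ℝ) (x y : Plane) : MeasurableSet (twoDisks r x y) :=
  Metric.isClosed_closedBall.measurableSet.union Metric.isClosed_closedBall.measurableSet

lemma isBounded_twoDisks (r : ℝ) (x y : Plane) : Bornology.IsBounded (twoDisks r x y) :=
  Metric.isBounded_closedBall.union Metric.isBounded_closedBall

lemma volume_twoDisks_ne_top (r : ℝ) (x y : Plane) : volume (twoDisks r x y) ≠ ∞ :=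
  (isBounded_twoDisks r x y).measure_lt_top.ne

lemma twoDisks_self (r : ℝ) (x : Plane) : twoDisks r x x = Metric.closedBall x r :=
  Set.union_self _

/-- The exponent in the definition of `g`. -/
def excess (rI Rp RI t : ℝ) : ℝ :=
  Real.pi * (rI ^ 2 + RI ^ 2 + II RI Rp rI) - SI t rI rI - SI t RI RI - doubleIntegral t rI Rp RI

/-- The mean number, per unit density, of transmitters that deny a given location an
opportunity. -/
def baseCoverage (rI Rp RI : ℝ) : ℝ :=
  Real.pi * (rI ^ 2 + RI ^ 2 - II RI Rp rI)

lemma overlap_twoDisks (x y : Plane) :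
    overlap Rp (twoDisks RI x y) (twoDisks rI x y) = doubleIntegral (dist x y) rI Rp RI := by
  obtain ⟨e, he, hx, hy⟩ := exists_isometryEquiv (x := x) (y := y)
    (x' := !₂[-dist x y / 2, 0]) (y' := !₂[dist x y / 2, 0]) (dist_centered dist_nonneg).symm
  have h : ∀ r, twoDisks r x y = e ⁻¹' SU2 (dist x y) r r := fun r => by
    rw [SU2, ← hy, ← hx, Set.preimage_union, preimage_closedBall_isometryEquiv,
      preimage_closedBall_isometryEquiv, twoDisks]
  rw [h, h, overlap_preimage_isometryEquiv he, overlap]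
  exact (setIntegral_polarPoint _ (measurableSet_twoDisks RI _ _)).symm

/-- Each union has area twice a disk minus the common part. Removing `baseCoverage`, which contains
`-II`, leaves one copy of each disk and `+II`; hence the sign of `II` in `g`. -/
lemma coverage_twoDisks (hrI : 0 ≤ rI) (hRp : 0 < Rp) (hRI : 0 ≤ RI) (x y : Plane) :
    coverage Rp (twoDisks RI x y) (twoDisks rI x y)
      = baseCoverage rI Rp RI + excess rI Rp RI (dist x y) := by
  rw [coverage_eq hRp (measurableSet_twoDisks _ _ _) (volume_twoDisks_ne_top _ _ _)
    (measurableSet_twoDisks _ _ _) (volume_twoDisks_ne_top _ _ _), overlap_twoDisks, twoDisks,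
    twoDisks, volumeReal_union_closedBall x y hrI, volumeReal_union_closedBall x y hRI,
    baseCoverage, excess]
  ring

lemma coverage_closedBall (hrI : 0 ≤ rI) (hRp : 0 < Rp) (hRI : 0 ≤ RI) (x : Plane) :
    coverage Rp (Metric.closedBall x RI) (Metric.closedBall x rI) = baseCoverage rI Rp RI := by
  have h : overlap Rp (Metric.closedBall x RI) (Metric.closedBall x rI)
      = Real.pi * II RI Rp rI := by
    simp_rw [overlap, ← SI_dist]
    simp_rw [fun z => dist_comm z x]
    rw [setIntegral_closedBall_dist (fun t => SI t Rp rI / (Real.pi * Rp ^ 2)) x hRI, II]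
    ring
  rw [coverage_eq hRp Metric.isClosed_closedBall.measurableSet measure_closedBall_lt_top.ne
    Metric.isClosed_closedBall.measurableSet measure_closedBall_lt_top.ne, h,
    volumeReal_closedBall x hrI, volumeReal_closedBall x hRI, baseCoverage]
  ring

/-- The forbidden marks, for varying `y`, are the sections of a single Borel set. -/
lemma measurable_coverage_twoDisks (hRp : 0 < Rp) (x : Plane) :
    Measurable fun y => coverage Rp (twoDisks RI x y) (twoDisks rI x y) := by
  have := isProbabilityMeasure_uniformDisk 0 hRp
  have hS : MeasurableSet {q : Plane × (Plane × Plane) |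
      (dist q.2.1 x ≤ RI ∨ dist q.2.1 q.1 ≤ RI)
        ∨ (dist (q.2.1 + q.2.2) x ≤ rI ∨ dist (q.2.1 + q.2.2) q.1 ≤ rI)} := by
    exact ((isClosed_le (f := fun q : Plane × (Plane × Plane) => dist q.2.1 x) (by fun_prop)
        continuous_const).union (isClosed_le (f := fun q : Plane × (Plane × Plane) =>
          dist q.2.1 q.1) (by fun_prop) continuous_const)).union
      ((isClosed_le (f := fun q : Plane × (Plane × Plane) => dist (q.2.1 + q.2.2) x) (by fun_prop)
        continuous_const).union (isClosed_le (f := fun q : Plane × (Plane × Plane) =>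
          dist (q.2.1 + q.2.2) q.1) (by fun_prop) continuous_const)) |>.measurableSet
  exact (measurable_measure_prodMk_left hS).ennreal_toReal

lemma exists_dist_lt_lt_dist {a b : Plane} (hab : a ≠ b) {R : ℝ} (hR : 0 < R) :
    ∃ w, dist w b < R ∧ R < dist w a := by
  have hd : 0 < ‖b - a‖ := norm_pos_iff.2 (sub_ne_zero.2 hab.symm)
  set d := ‖b - a‖
  -- The point `b + s • (b - a)` lies on the ray from `a` through `b`, beyond `b` by `max 0 (R - d /
  -- 2)`: less than `R` from `b`, at least `R + d / 2` from `a`.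
  set s := max 0 (R / d - 1 / 2)
  have hs : 0 ≤ s := le_max_left _ _
  have hsd : s * d = max 0 (R - d / 2) := by
    rw [max_mul_of_nonneg _ _ hd.le, zero_mul]
    congr 1
    field_simp
  refine ⟨b + s • (b - a), ?_, ?_⟩
  · rw [dist_eq_norm, add_sub_cancel_left, norm_smul, Real.norm_of_nonneg hs, hsd]
    exact max_lt hR (by linarith)
  · rw [dist_eq_norm, show b + s • (b - a) - a = (1 + s) • (b - a) by module, norm_smul,
      Real.norm_of_nonneg (by positivity), add_mul, hsd]
    linarith [le_max_right 0 (R - d / 2)]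

/-- The uniform law charges every neighbourhood of the zero offset, and area charges every
neighbourhood of `w`. -/
lemma measure_prod_uniformDisk_pos (hRp : 0 < Rp) {U : Set (Plane × Plane)} (hU : IsOpen U)
    (w : Plane) (hw : (w, (0 : Plane)) ∈ U) : 0 < volume.prod (uniformDisk 0 Rp) U := by
  have := isProbabilityMeasure_uniformDisk 0 hRp
  obtain ⟨V, V', hV, hV', hwV, h0V, hsub⟩ := isOpen_prod_iff.1 hU w 0 hw
  refine lt_of_lt_of_le ?_ (measure_mono hsub)
  rw [Measure.prod_prod]
  refine ENNReal.mul_pos (hV.measure_pos volume ⟨w, hwV⟩).ne' ?_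
  rw [uniformDisk, cond_apply Metric.isClosed_closedBall.measurableSet]
  refine (ENNReal.mul_pos (ENNReal.inv_ne_zero.2 measure_closedBall_lt_top.ne) ?_).ne'
  refine (lt_of_lt_of_le ((Metric.isOpen_ball.inter hV').measure_pos volume
    ⟨0, Metric.mem_ball_self hRp, h0V⟩) (measure_mono ?_)).ne'
  exact Set.inter_subset_inter_left _ Metric.ball_subset_closedBall

lemma coverage_closedBall_lt_coverage_twoDisks (hrI : 0 < rI) (hRp : 0 < Rp) (hRI : 0 < RI)
    {a b : Plane} (hab : a ≠ b) :
    coverage Rp (Metric.closedBall a RI) (Metric.closedBall a rI)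
      < coverage Rp (twoDisks RI a b) (twoDisks rI a b) := by
  have := isProbabilityMeasure_uniformDisk 0 hRp
  set S := coveredMarks (Metric.closedBall a RI) (Metric.closedBall a rI) with hS
  set T := coveredMarks (twoDisks RI a b) (twoDisks rI a b) with hT
  have hST : S ⊆ T := fun p hp => hp.imp Or.inl Or.inl
  have hSm : MeasurableSet S := measurableSet_coveredMarks
    Metric.isClosed_closedBall.measurableSet Metric.isClosed_closedBall.measurableSet
  have hTt : volume.prod (uniformDisk 0 Rp) T ≠ ∞ := measure_coveredMarks_ne_top hRp
    (volume_twoDisks_ne_top _ _ _) (measurableSet_twoDisks _ _ _) (volume_twoDisks_ne_top _ _ _)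
  have hpos : 0 < volume.prod (uniformDisk 0 Rp) (T \ S) := by
    -- Use the larger radius: a point within it of `b` but beyond it from `a` lies outside both
    -- disks about `a`. Placing the transmitter there with zero offset puts the receiver outside as
    -- well, and all the inequalities are open.
    rcases le_total rI RI with hle | hle
    · obtain ⟨w, hwb, hwa⟩ := exists_dist_lt_lt_dist hab hRI
      refine lt_of_lt_of_le (measure_prod_uniformDisk_pos hRp (U := {p : Plane × Plane |
        dist p.1 b < RI ∧ RI < dist p.1 a ∧ rI < dist (p.1 + p.2) a}) ?_ w
        ⟨hwb, hwa, by simpa using hle.trans_lt hwa⟩) (measure_mono fun p hp => ?_)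
      · exact IsOpen.and (isOpen_lt (by fun_prop) (by fun_prop))
          (IsOpen.and (isOpen_lt (by fun_prop) (by fun_prop))
            (isOpen_lt (by fun_prop) (by fun_prop)))
      · exact ⟨Or.inl (Or.inr hp.1.le), fun h => h.elim (not_le.2 hp.2.1) (not_le.2 hp.2.2)⟩
    · obtain ⟨w, hwb, hwa⟩ := exists_dist_lt_lt_dist hab hrI
      refine lt_of_lt_of_le (measure_prod_uniformDisk_pos hRp (U := {p : Plane × Plane |
        dist (p.1 + p.2) b < rI ∧ RI < dist p.1 a ∧ rI < dist (p.1 + p.2) a}) ?_ w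
        ⟨by simpa using hwb, hle.trans_lt hwa, by simpa using hwa⟩)
        (measure_mono fun p hp => ?_)
      · exact IsOpen.and (isOpen_lt (by fun_prop) (by fun_prop))
          (IsOpen.and (isOpen_lt (by fun_prop) (by fun_prop))
            (isOpen_lt (by fun_prop) (by fun_prop)))
      · exact ⟨Or.inr (Or.inr hp.1.le), fun h => h.elim (not_le.2 hp.2.1) (not_le.2 hp.2.2)⟩
  have hdiff := measureReal_sdiff_add_inter (μ := volume.prod (uniformDisk 0 Rp)) (s := T) hSm hTt
  rw [Set.inter_eq_right.2 hST] at hdiff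
  rw [coverage, coverage, ← hS, ← hT, ← hdiff]
  exact lt_add_of_pos_left _ (ENNReal.toReal_pos hpos.ne'
    (measure_ne_top_of_subset Set.sdiff_subset hTt))

lemma excess_pos (hrI : 0 < rI) (hRp : 0 < Rp) (hRI : 0 < RI) {t : ℝ} (ht : 0 < t) :
    0 < excess rI Rp RI t := by
  have hd := dist_origin_left ht.le
  have hne : (!₂[0, 0] : Plane) ≠ !₂[t, 0] := dist_pos.1 (by rwa [hd])
  have h := coverage_closedBall_lt_coverage_twoDisks hrI hRp hRI hne
  rw [coverage_closedBall hrI.le hRp hRI.le, coverage_twoDisks hrI.le hRp hRI.le, hd] at h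
  linarith

/-- For `t > 0` the exponent is a coverage minus a constant, so it inherits measurability from
`measurable_coverage_twoDisks`. -/
lemma aestronglyMeasurable_excess (hrI : 0 < rI) (hRp : 0 < Rp) (hRI : 0 < RI) (r : ℝ) :
    AEStronglyMeasurable (excess rI Rp RI) (volume.restrict (Set.Ioc 0 r)) := by
  have hm : Measurable fun t : ℝ => (!₂[t, 0] : Plane) := by
    refine (WithLp.measurable_toLp 2 _).comp (measurable_pi_iff.2 fun i => ?_)
    fin_cases i
    · exact measurable_id
    · exact measurable_const
  have h := ((measurable_coverage_twoDisks (rI := rI) (RI := RI) hRp !₂[0, 0]).comp hm).sub_const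
    (baseCoverage rI Rp RI)
  refine h.aestronglyMeasurable.congr ?_
  filter_upwards [ae_restrict_mem measurableSet_Ioc] with t ht
  simp [coverage_twoDisks hrI.le hRp hRI.le, dist_origin_left ht.1.le]

end OpportunityGeometry

/-! ### Probabilities of opportunities, and averaging over secondary users -/

section Opportunities

/-- The primary network as a random sequence. -/
def primary {Ω : Type*} (tx rx : ℕ → Ω → Plane) (ω : Ω) : ℕ → Plane × Plane :=
  fun i => (tx i ω, rx i ω)

/-- The primary networks that leave an opportunity to a user at `a`. -/
def PrimaryOpportunity (rI RI : ℝ) (w : ℕ → Plane × Plane) (a : Plane) : Prop :=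
  SeesOpportunity (fun i => (w i).1) (fun i => (w i).2) rI RI a

lemma oppEvent_inter_oppEvent {Ω : Type*} (tx rx : ℕ → Ω → Plane) (rI RI : ℝ) (a b : Plane) :
    oppEvent tx rx rI RI a ∩ oppEvent tx rx rI RI b
      = {ω | ∀ i, (tx i ω, rx i ω - tx i ω)
          ∉ coveredMarks (twoDisks RI a b) (twoDisks rI a b)} := by
  ext ω
  simp only [oppEvent, SeesOpportunity, coveredMarks, twoDisks, Set.mem_inter_iff,
    Set.mem_ofPred_eq, Set.mem_union, Metric.mem_closedBall, not_exists, not_or,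
    add_sub_cancel]
  exact ⟨fun h i => ⟨⟨h.1.2 i, h.2.2 i⟩, h.1.1 i, h.2.1 i⟩,
    fun h => ⟨⟨fun i => (h i).2.1, fun i => (h i).1.1⟩, fun i => (h i).2.2, fun i => (h i).1.2⟩⟩

variable {Ω : Type*} [MeasurableSpace Ω] {P : Measure Ω} {lamS lamPT rp rI Rp RI : ℝ}
  {su tx rx : ℕ → Ω → Plane}

lemma IsNetwork.measure_oppEvent_inter_eq_coverage [IsProbabilityMeasure P]
    (h : IsNetwork P lamS lamPT Rp su tx rx) (hlam : 0 ≤ lamPT) (hRp : 0 < Rp) (a b : Plane) :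
    P (oppEvent tx rx rI RI a ∩ oppEvent tx rx rI RI b)
      = ENNReal.ofReal (Real.exp
        (-(lamPT * coverage Rp (twoDisks RI a b) (twoDisks rI a b)))) := by
  rw [oppEvent_inter_oppEvent]
  exact h.measure_forall_notMem hlam hRp
    (measurableSet_coveredMarks (measurableSet_twoDisks _ _ _) (measurableSet_twoDisks _ _ _))
    (volume_support_uniformDisk_ne_top (isBounded_twoDisks _ _ _) (isBounded_twoDisks _ _ _))

lemma IsNetwork.measure_oppEvent [IsProbabilityMeasure P]
    (h : IsNetwork P lamS lamPT Rp su tx rx) (hlam : 0 ≤ lamPT) (hrI : 0 < rI) (hRp : 0 < Rp)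
    (hRI : 0 < RI) (a : Plane) :
    P (oppEvent tx rx rI RI a)
      = ENNReal.ofReal (Real.exp (-(lamPT * baseCoverage rI Rp RI))) := by
  have := h.measure_oppEvent_inter_eq_coverage (rI := rI) (RI := RI) hlam hRp a a
  rwa [Set.inter_self, twoDisks_self, twoDisks_self, coverage_closedBall hrI.le hRp hRI.le]
    at this

lemma g_eq (lamPT rp rI Rp RI : ℝ) :
    g lamPT rp rI Rp RI
      = ∫ t in (0 : ℝ)..rp, 2 * t / rp ^ 2 * Real.exp (-lamPT * excess rI Rp RI t) :=
  rfl

lemma g_nonneg (hrp : 0 < rp) : 0 ≤ g lamPT rp rI Rp RI := by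
  rw [g_eq]
  refine intervalIntegral.integral_nonneg hrp.le fun t ht => ?_
  have := ht.1
  positivity

/-- The expected area of the locations within distance `rp` of `a` that see an opportunity
together with `a`. -/
lemma IsNetwork.lintegral_measure_oppEvent_inter [IsProbabilityMeasure P]
    (h : IsNetwork P lamS lamPT Rp su tx rx) (hlam : 0 ≤ lamPT) (hrp : 0 < rp) (hrI : 0 < rI)
    (hRp : 0 < Rp) (hRI : 0 < RI) (a : Plane) :
    ∫⁻ y in Metric.closedBall a rp, P (oppEvent tx rx rI RI a ∩ oppEvent tx rx rI RI y)
      = P (oppEvent tx rx rI RI a)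
        * ENNReal.ofReal (Real.pi * rp ^ 2 * g lamPT rp rI Rp RI) := by
  have hm : Measurable fun y => Real.exp
      (-(lamPT * coverage Rp (twoDisks RI a y) (twoDisks rI a y))) :=
    Real.measurable_exp.comp ((measurable_coverage_twoDisks hRp a).const_mul lamPT).neg
  have hint : IntegrableOn (fun y => Real.exp
      (-(lamPT * coverage Rp (twoDisks RI a y) (twoDisks rI a y)))) (Metric.closedBall a rp) := by
    refine Measure.integrableOn_of_bounded (M := 1) measure_closedBall_lt_top.ne
      hm.aestronglyMeasurable (.of_forall fun y => ?_)
    rw [Real.norm_of_nonneg (Real.exp_pos _).le, Real.exp_le_one_iff, neg_nonpos]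
    exact mul_nonneg hlam measureReal_nonneg
  simp_rw [h.measure_oppEvent_inter_eq_coverage hlam hRp]
  rw [← ofReal_integral_eq_lintegral_ofReal hint (.of_forall fun y => (Real.exp_pos _).le),
    h.measure_oppEvent hlam hrI hRp hRI, ← ENNReal.ofReal_mul (Real.exp_pos _).le]
  congr 1
  simp_rw [coverage_twoDisks hrI.le hRp hRI.le]
  -- The joint probability depends on `y` only through its distance to `a`, so the area integral
  -- becomes the one-dimensional integral in `g`.
  rw [setIntegral_closedBall_dist
    (fun t => Real.exp (-(lamPT * (baseCoverage rI Rp RI + excess rI Rp RI t)))) a hrp.le, g_eq,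
    ← intervalIntegral.integral_const_mul, ← intervalIntegral.integral_const_mul,
    ← intervalIntegral.integral_const_mul]
  refine intervalIntegral.integral_congr fun t _ => ?_
  rw [mul_add, neg_add, Real.exp_add, neg_mul]
  field_simp

lemma measurableSet_primaryOpportunity (rI RI : ℝ) :
    MeasurableSet {q : (ℕ → Plane × Plane) × Plane | PrimaryOpportunity rI RI q.1 q.2} := by
  have h : {q : (ℕ → Plane × Plane) × Plane | PrimaryOpportunity rI RI q.1 q.2}
      = (⋃ i, {q | dist (q.1 i).2 q.2 ≤ rI})ᶜ ∩ (⋃ i, {q | dist (q.1 i).1 q.2 ≤ RI})ᶜ := by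
    ext q
    simp [PrimaryOpportunity, SeesOpportunity]
  rw [h]
  exact (MeasurableSet.iUnion fun i => measurableSet_le (by fun_prop) measurable_const).compl.inter
    (MeasurableSet.iUnion fun i => measurableSet_le (by fun_prop) measurable_const).compl

namespace IsNetwork

lemma measurable_primary (h : IsNetwork P lamS lamPT Rp su tx rx) :
    Measurable (primary tx rx) :=
  measurable_pi_iff.2 fun i => (h.transmitters.measurable i).prodMk (h.measurable_rx i)

lemma measurableSet_oppEvent (h : IsNetwork P lamS lamPT Rp su tx rx) (a : Plane) :
    MeasurableSet (oppEvent tx rx rI RI a) :=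
  (h.measurable_primary.prodMk measurable_const) (measurableSet_primaryOpportunity rI RI)

lemma measurableSet_prod_oppEvent (h : IsNetwork P lamS lamPT Rp su tx rx) :
    MeasurableSet {p : Ω × Plane | p.1 ∈ oppEvent tx rx rI RI p.2} :=
  ((h.measurable_primary.comp measurable_fst).prodMk measurable_snd)
    (measurableSet_primaryOpportunity rI RI)

variable [IsProbabilityMeasure P]

/-- Independence makes the joint law a product; Fubini then freezes the primary network while
averaging over the secondary users. -/
lemma lintegral_comp_secondary_primary (h : IsNetwork P lamS lamPT Rp su tx rx)
    {H : (ℕ → Plane) × (ℕ → Plane × Plane) → ℝ≥0∞} (hH : Measurable H) :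
    ∫⁻ ω, H (fun i => su i ω, primary tx rx ω) ∂P
      = ∫⁻ ω', ∫⁻ ω, H (fun i => su i ω, primary tx rx ω') ∂P ∂P := by
  have hs : Measurable fun ω i => su i ω := measurable_pi_iff.2 h.secondary.measurable
  have hp := h.measurable_primary
  have he := (indepFun_iff_map_prod_eq_prod_map_map hs.aemeasurable hp.aemeasurable).1
    h.indep_secondary
  rw [← lintegral_map hH (hs.prodMk hp), he, lintegral_prod_symm _ hH.aemeasurable,
    lintegral_map hH.lintegral_prod_left' hp]
  refine lintegral_congr fun ω' => ?_
  exact lintegral_map (hH.comp measurable_prodMk_right) hs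

lemma lintegral_tsum_secondary (h : IsNetwork P lamS lamPT Rp su tx rx) (hlam : 0 ≤ lamS)
    {f : (ℕ → Plane × Plane) × Plane → ℝ≥0∞} (hf : Measurable f) :
    ∫⁻ ω, ∑' i, f (primary tx rx ω, su i ω) ∂P
      = lamS.toNNReal * ∫⁻ x, ∫⁻ ω, f (primary tx rx ω, x) ∂P := by
  have hfp : Measurable fun p : Ω × Plane => f (primary tx rx p.1, p.2) :=
    hf.comp ((h.measurable_primary.comp measurable_fst).prodMk measurable_snd)
  rw [h.lintegral_comp_secondary_primary
    (H := fun q => ∑' i, f (q.2, q.1 i)) (Measurable.tsum fun i => hf.comp (by fun_prop))]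
  simp_rw [fun ω' => h.secondary.lintegral_tsum_comp hlam
    (f := fun x => f (primary tx rx ω', x)) (hf.comp measurable_prodMk_left)]
  rw [lintegral_const_mul _ hfp.lintegral_prod_right', lintegral_lintegral_swap hfp.aemeasurable]

lemma lintegral_tsum_tsum_secondary (h : IsNetwork P lamS lamPT Rp su tx rx) (hlam : 0 ≤ lamS)
    {f : (ℕ → Plane × Plane) × (Plane × Plane) → ℝ≥0∞} (hf : Measurable f) :
    ∫⁻ ω, ∑' i, ∑' j, (if j = i then 0 else f (primary tx rx ω, (su i ω, su j ω))) ∂P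
      = lamS.toNNReal * (lamS.toNNReal *
        ∫⁻ x, ∫⁻ y, ∫⁻ ω, f (primary tx rx ω, (x, y)) ∂P) := by
  have hfp : Measurable fun p : Ω × (Plane × Plane) => f (primary tx rx p.1, p.2) :=
    hf.comp ((h.measurable_primary.comp measurable_fst).prodMk measurable_snd)
  rw [h.lintegral_comp_secondary_primary
    (H := fun q => ∑' i, ∑' j, (if j = i then 0 else f (q.2, (q.1 i, q.1 j))))
    (Measurable.tsum fun i => Measurable.tsum fun j => by
      split_ifs
      · exact measurable_const
      · exact hf.comp (by fun_prop))]
  simp_rw [fun ω' => h.secondary.lintegral_tsum_tsum_comp hlam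
    (f := fun x => f (primary tx rx ω', x)) (hf.comp measurable_prodMk_left)]
  have hpair : ∀ ω', ∫⁻ x, ∫⁻ y, f (primary tx rx ω', (x, y))
      = ∫⁻ z : Plane × Plane, f (primary tx rx ω', z) := fun ω' =>
    (lintegral_prod (fun z => f (primary tx rx ω', z))
      (hf.comp measurable_prodMk_left).aemeasurable).symm
  simp_rw [hpair]
  rw [lintegral_const_mul _ (hfp.lintegral_prod_right'.const_mul _),
    lintegral_const_mul _ hfp.lintegral_prod_right', lintegral_lintegral_swap hfp.aemeasurable]
  congr 2
  exact lintegral_prod _ hfp.lintegral_prod_left'.aemeasurable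

end IsNetwork

end Opportunities

/-! ### Degrees, monotonicity of `g` and the final formulas -/

section Degrees

lemma deg_eq_tsum {ι : Type*} (s : ι → Plane) (tx rx : ℕ → Plane) (rp rI RI : ℝ) (i : ι) :
    deg s tx rx rp rI RI i
      = ∑' j, ((linkGraph s tx rx rp rI RI).neighborSet i).indicator 1 j := by
  rw [deg, ← ENNReal.tsum_set_one, tsum_subtype _ (fun _ => (1 : ℝ≥0∞))]
  rfl

/-- The primary networks and locations `y` for which users at `a` and `y` are linked. -/
def linkedTo (rp rI RI : ℝ) (a : Plane) : Set ((ℕ → Plane × Plane) × Plane) :=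
  {q | dist a q.2 ≤ rp ∧ PrimaryOpportunity rI RI q.1 a ∧ PrimaryOpportunity rI RI q.1 q.2}

/-- The primary networks and pairs of locations for which users at these locations are linked. -/
def linkedPairs (rp rI RI : ℝ) : Set ((ℕ → Plane × Plane) × (Plane × Plane)) :=
  {q | dist q.2.1 q.2.2 ≤ rp ∧ PrimaryOpportunity rI RI q.1 q.2.1
    ∧ PrimaryOpportunity rI RI q.1 q.2.2}

lemma measurableSet_linkedPairs (rp rI RI : ℝ) : MeasurableSet (linkedPairs rp rI RI) := by
  have h1 : Measurable fun q : (ℕ → Plane × Plane) × (Plane × Plane) => (q.1, q.2.1) := by fun_prop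
  have h2 : Measurable fun q : (ℕ → Plane × Plane) × (Plane × Plane) => (q.1, q.2.2) := by fun_prop
  exact (measurableSet_le (f := fun q : (ℕ → Plane × Plane) × (Plane × Plane) =>
    dist q.2.1 q.2.2) (by fun_prop) measurable_const).inter
    ((h1 (measurableSet_primaryOpportunity rI RI)).inter
      (h2 (measurableSet_primaryOpportunity rI RI)))

lemma measurableSet_linkedTo (rp rI RI : ℝ) (a : Plane) : MeasurableSet (linkedTo rp rI RI a) :=
  (show Measurable fun q : (ℕ → Plane × Plane) × Plane => (q.1, (a, q.2)) by fun_prop)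
    (measurableSet_linkedPairs rp rI RI)

lemma deg_addUser_eq_tsum {Ω : Type*} (su tx rx : ℕ → Ω → Plane) (rp rI RI : ℝ) (a : Plane)
    (ω : Ω) :
    deg (addUser a (su · ω)) (tx · ω) (rx · ω) rp rI RI none
      = ∑' j, (linkedTo rp rI RI a).indicator 1 (primary tx rx ω, su j ω) := by
  have h : (linkGraph (addUser a (su · ω)) (tx · ω) (rx · ω) rp rI RI).neighborSet none
      = some '' {j | (primary tx rx ω, su j ω) ∈ linkedTo rp rI RI a} := by
    ext o
    cases o with
    | none => simp
    | some j =>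
      simp [linkGraph, addUser, linkedTo, PrimaryOpportunity, primary]
  rw [deg, h, (Option.some_injective ℕ).encard_image, ← ENNReal.tsum_set_one,
    tsum_subtype _ (fun _ => (1 : ℝ≥0∞))]
  rfl

open Classical in
lemma tsum_ite_deg_eq {Ω : Type*} (su tx rx : ℕ → Ω → Plane) (rp rI RI : ℝ) (W : Set Plane)
    (ω : Ω) :
    (∑' i, if su i ω ∈ W ∧ SeesOpportunity (tx · ω) (rx · ω) rI RI (su i ω)
      then deg (su · ω) (tx · ω) (rx · ω) rp rI RI i else 0)
      = ∑' i, ∑' j, if j = i then 0 else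
        W.indicator 1 (su i ω)
          * (linkedPairs rp rI RI).indicator 1 (primary tx rx ω, (su i ω, su j ω)) := by
  refine tsum_congr fun i => ?_
  split_ifs with hi
  · rw [deg_eq_tsum]
    refine tsum_congr fun j => ?_
    rw [Set.indicator_of_mem hi.1, Pi.one_apply, one_mul]
    split_ifs with hj
    · rw [Set.indicator_of_notMem]
      simp [hj]
    · by_cases hl : (primary tx rx ω, (su i ω, su j ω)) ∈ linkedPairs rp rI RI
      · rw [Set.indicator_of_mem hl, Set.indicator_of_mem]
        · rfl
        · exact ⟨fun h => hj h.symm, hl⟩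
      · rw [Set.indicator_of_notMem hl, Set.indicator_of_notMem]
        exact fun h => hl h.2
  · symm
    rw [ENNReal.tsum_eq_zero]
    intro j
    split_ifs
    · rfl
    · by_cases hW : su i ω ∈ W
      · rw [Set.indicator_of_notMem (s := linkedPairs rp rI RI), mul_zero]
        exact fun h => hi ⟨hW, h.2.1⟩
      · rw [Set.indicator_of_notMem hW, zero_mul]

open Classical in
lemma tsum_ite_one_eq {Ω : Type*} (su tx rx : ℕ → Ω → Plane) (rI RI : ℝ) (W : Set Plane)
    (ω : Ω) :
    (∑' i, if su i ω ∈ W ∧ SeesOpportunity (tx · ω) (rx · ω) rI RI (su i ω) then (1 : ℝ≥0∞) else 0)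
      = ∑' i, W.indicator 1 (su i ω)
        * {q : (ℕ → Plane × Plane) × Plane | PrimaryOpportunity rI RI q.1 q.2}.indicator 1
          (primary tx rx ω, su i ω) := by
  refine tsum_congr fun i => ?_
  by_cases hW : su i ω ∈ W
  · by_cases hO : SeesOpportunity (tx · ω) (rx · ω) rI RI (su i ω)
    · rw [if_pos ⟨hW, hO⟩, Set.indicator_of_mem hW, Set.indicator_of_mem (by exact hO)]
      simp
    · rw [if_neg fun h => hO h.2, Set.indicator_of_notMem (s := Set.ofPred _) (by exact hO),
        mul_zero]
  · rw [if_neg fun h => hW h.1, Set.indicator_of_notMem hW, zero_mul]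

variable {lamS lamPT rp rI Rp RI : ℝ}

lemma coe_toNNReal_mul_ofReal (hlamS : 0 < lamS) (c : ℝ) :
    (lamS.toNNReal : ℝ≥0∞) * ENNReal.ofReal (Real.pi * rp ^ 2 * c)
      = ENNReal.ofReal (lamS * Real.pi * rp ^ 2 * c) := by
  rw [show (lamS.toNNReal : ℝ≥0∞) = ENNReal.ofReal lamS from rfl, ← ENNReal.ofReal_mul hlamS.le]
  congr 1
  ring

theorem strictAntiOn_g (hrp : 0 < rp) (hrI : 0 < rI) (hRp : 0 < Rp) (hRI : 0 < RI) :
    StrictAntiOn (fun lamPT => g lamPT rp rI Rp RI) (Set.Ici 0) := by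
  have hint : ∀ lam : ℝ, 0 ≤ lam → IntervalIntegrable
      (fun t => 2 * t / rp ^ 2 * Real.exp (-lam * excess rI Rp RI t)) volume 0 rp := by
    intro lam hlam
    rw [intervalIntegrable_iff_integrableOn_Ioc_of_le hrp.le]
    refine Integrable.of_bound ?_ (2 / rp) ?_
    · exact AEStronglyMeasurable.mul (by fun_prop) (Real.continuous_exp.comp_aestronglyMeasurable
        ((aestronglyMeasurable_excess hrI hRp hRI rp).const_mul _))
    · filter_upwards [ae_restrict_mem measurableSet_Ioc] with t ht
      have ht0 := ht.1
      have hexp : Real.exp (-lam * excess rI Rp RI t) ≤ 1 := by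
        rw [Real.exp_le_one_iff, neg_mul, neg_nonpos]
        exact mul_nonneg hlam (excess_pos hrI hRp hRI ht0).le
      rw [Real.norm_of_nonneg (by positivity)]
      calc 2 * t / rp ^ 2 * Real.exp (-lam * excess rI Rp RI t)
          ≤ 2 * t / rp ^ 2 * 1 := by gcongr
        _ ≤ 2 * rp / rp ^ 2 * 1 := by gcongr; exact ht.2
        _ = 2 / rp := by field_simp
  intro l hl m hm hlm
  have hl' := hint l hl
  have hm' := hint m hm
  refine sub_pos.1 ?_
  simp only [g_eq]
  rw [← intervalIntegral.integral_sub hl' hm']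
  -- Only the open interval matters: there both `t` and the exponent are positive, so the integrands
  -- compare strictly.
  refine intervalIntegral.intervalIntegral_pos_of_pos_on (hl'.sub hm') (fun t ht => ?_) hrp
  have ht0 := ht.1
  have he := excess_pos hrI hRp hRI ht0
  rw [← mul_sub]
  refine mul_pos (by positivity) (sub_pos.2 (Real.exp_lt_exp.2 ?_))
  nlinarith

variable {Ω : Type*} [MeasurableSpace Ω] {P : Measure Ω} {su tx rx : ℕ → Ω → Plane}

namespace IsNetwork

lemma lintegral_linkedPairs (h : IsNetwork P lamS lamPT Rp su tx rx) (x y : Plane) :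
    ∫⁻ ω, (linkedPairs rp rI RI).indicator 1 (primary tx rx ω, (x, y)) ∂P
      = (Metric.closedBall x rp).indicator
        (fun y => P (oppEvent tx rx rI RI x ∩ oppEvent tx rx rI RI y)) y := by
  by_cases hy : dist x y ≤ rp
  · rw [Set.indicator_of_mem (by rwa [Metric.mem_closedBall, dist_comm]),
      ← lintegral_indicator_one ((h.measurableSet_oppEvent x).inter (h.measurableSet_oppEvent y))]
    refine lintegral_congr fun ω => ?_
    by_cases hω : ω ∈ oppEvent tx rx rI RI x ∩ oppEvent tx rx rI RI y
    · rw [Set.indicator_of_mem hω, Set.indicator_of_mem (by exact ⟨hy, hω⟩)]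
      rfl
    · rw [Set.indicator_of_notMem hω, Set.indicator_of_notMem (fun hq => hω hq.2)]
  · rw [Set.indicator_of_notMem (by rwa [Metric.mem_closedBall, dist_comm])]
    have h0 : ∀ ω, (linkedPairs rp rI RI).indicator (fun _ => (1 : ℝ≥0∞))
        (primary tx rx ω, (x, y)) = 0 := fun ω =>
      Set.indicator_of_notMem (fun hq => hy hq.1) _
    exact (lintegral_congr h0).trans lintegral_zero

variable [IsProbabilityMeasure P]

lemma measure_oppEvent_ne_zero (h : IsNetwork P lamS lamPT Rp su tx rx) (hlam : 0 ≤ lamPT)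
    (hrI : 0 < rI) (hRp : 0 < Rp) (hRI : 0 < RI) (a : Plane) :
    P (oppEvent tx rx rI RI a) ≠ 0 := by
  rw [h.measure_oppEvent hlam hrI hRp hRI]
  exact (ENNReal.ofReal_pos.2 (Real.exp_pos _)).ne'

lemma lintegral_lintegral_linkedPairs (h : IsNetwork P lamS lamPT Rp su tx rx)
    (hlam : 0 ≤ lamPT) (hrp : 0 < rp) (hrI : 0 < rI) (hRp : 0 < Rp) (hRI : 0 < RI) (x : Plane) :
    ∫⁻ y, ∫⁻ ω, (linkedPairs rp rI RI).indicator 1 (primary tx rx ω, (x, y)) ∂P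
      = P (oppEvent tx rx rI RI x)
        * ENNReal.ofReal (Real.pi * rp ^ 2 * g lamPT rp rI Rp RI) := by
  simp_rw [h.lintegral_linkedPairs]
  rw [lintegral_indicator Metric.isClosed_closedBall.measurableSet,
    h.lintegral_measure_oppEvent_inter hlam hrp hrI hRp hRI]

theorem condAvgDegreeAt_eq (h : IsNetwork P lamS lamPT Rp su tx rx) (hlamS : 0 < lamS)
    (hlam : 0 ≤ lamPT) (hrp : 0 < rp) (hrI : 0 < rI) (hRp : 0 < Rp) (hRI : 0 < RI) (a : Plane) :
    condAvgDegreeAt P su tx rx rp rI RI a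
      = ENNReal.ofReal (lamS * Real.pi * rp ^ 2 * g lamPT rp rI Rp RI) := by
  -- A link at `a` already requires that `a` sees an opportunity, so the restriction to this event
  -- is absorbed by the indicator.
  have hset : ∫⁻ ω in oppEvent tx rx rI RI a,
        deg (addUser a (su · ω)) (tx · ω) (rx · ω) rp rI RI none ∂P
      = ∫⁻ ω, ∑' j, (linkedTo rp rI RI a).indicator 1 (primary tx rx ω, su j ω) ∂P := by
    rw [← lintegral_indicator (h.measurableSet_oppEvent a)]
    refine lintegral_congr fun ω => ?_
    by_cases hω : ω ∈ oppEvent tx rx rI RI a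
    · rw [Set.indicator_of_mem hω, deg_addUser_eq_tsum]
    · rw [Set.indicator_of_notMem hω]
      symm
      rw [ENNReal.tsum_eq_zero]
      exact fun j => Set.indicator_of_notMem (fun hq => hω hq.2.1) _
  rw [condAvgDegreeAt, ProbabilityTheory.cond, lintegral_smul_measure, hset,
    h.lintegral_tsum_secondary hlamS.le (measurable_one.indicator (measurableSet_linkedTo _ _ _ a))]
  have hl := h.lintegral_lintegral_linkedPairs (rp := rp) (rI := rI) (RI := RI) hlam hrp hrI hRp
    hRI a
  rw [show ∫⁻ y, ∫⁻ ω, (linkedTo rp rI RI a).indicator 1 (primary tx rx ω, y) ∂P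
    = _ from hl, smul_eq_mul, mul_left_comm (lamS.toNNReal : ℝ≥0∞), ← mul_assoc,
    ENNReal.inv_mul_cancel (h.measure_oppEvent_ne_zero hlam hrI hRp hRI a) (measure_ne_top _ _),
    one_mul, coe_toNNReal_mul_ofReal hlamS]

theorem condAvgDegree_eq (h : IsNetwork P lamS lamPT Rp su tx rx) (hlamS : 0 < lamS)
    (hlam : 0 ≤ lamPT) (hrp : 0 < rp) (hrI : 0 < rI) (hRp : 0 < Rp) (hRI : 0 < RI)
    {W : Set Plane} (hW : MeasurableSet W) (hW0 : 0 < volume W) (hW' : volume W < ∞) :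
    condAvgDegree P su tx rx rp rI RI W
      = ENNReal.ofReal (lamS * Real.pi * rp ^ 2 * g lamPT rp rI Rp RI) := by
  have hWm : Measurable (W.indicator (1 : Plane → ℝ≥0∞)) := measurable_one.indicator hW
  have hLm : Measurable ((linkedPairs rp rI RI).indicator
      (1 : (ℕ → Plane × Plane) × (Plane × Plane) → ℝ≥0∞)) :=
    measurable_one.indicator (measurableSet_linkedPairs _ _ _)
  have hOm : Measurable ({q : (ℕ → Plane × Plane) × Plane |
      PrimaryOpportunity rI RI q.1 q.2}.indicator
      (1 : (ℕ → Plane × Plane) × Plane → ℝ≥0∞)) :=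
    measurable_one.indicator (measurableSet_primaryOpportunity _ _)
  set p := ENNReal.ofReal (Real.exp (-(lamPT * baseCoverage rI Rp RI))) with hp
  set c := ENNReal.ofReal (Real.pi * rp ^ 2 * g lamPT rp rI Rp RI) with hc
  have hp0 : p ≠ 0 := (ENNReal.ofReal_pos.2 (Real.exp_pos _)).ne'
  have hnum : ∀ x, ∫⁻ y, ∫⁻ ω, W.indicator 1 x
        * (linkedPairs rp rI RI).indicator 1 (primary tx rx ω, (x, y)) ∂P
      = W.indicator 1 x * (p * c) := fun x => by
    have hm : ∀ y, Measurable fun ω =>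
        (linkedPairs rp rI RI).indicator (fun _ => (1 : ℝ≥0∞)) (primary tx rx ω, (x, y)) := fun y =>
      hLm.comp (h.measurable_primary.prodMk measurable_const)
    have hm' : Measurable fun q : Ω × Plane =>
        (linkedPairs rp rI RI).indicator (fun _ => (1 : ℝ≥0∞)) (primary tx rx q.1, (x, q.2)) :=
      hLm.comp ((h.measurable_primary.comp measurable_fst).prodMk
        (measurable_const.prodMk measurable_snd))
    refine (lintegral_congr fun y =>
      lintegral_const_mul (μ := P) (W.indicator 1 x) (hm y)).trans ?_
    refine (lintegral_const_mul _ hm'.lintegral_prod_left').trans ?_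
    rw [hp, ← h.measure_oppEvent hlam hrI hRp hRI x]
    exact congrArg _ (h.lintegral_lintegral_linkedPairs hlam hrp hrI hRp hRI x)
  have hden : ∀ x, ∫⁻ ω, W.indicator 1 x
        * {q : (ℕ → Plane × Plane) × Plane | PrimaryOpportunity rI RI q.1 q.2}.indicator 1
          (primary tx rx ω, x) ∂P
      = W.indicator 1 x * p := fun x => by
    refine (lintegral_const_mul _
      (hOm.comp (h.measurable_primary.prodMk measurable_const))).trans ?_
    rw [hp, ← h.measure_oppEvent hlam hrI hRp hRI x,
      ← lintegral_indicator_one (h.measurableSet_oppEvent x)]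
    rfl
  rw [condAvgDegree]
  simp_rw [tsum_ite_deg_eq, tsum_ite_one_eq]
  rw [h.lintegral_tsum_tsum_secondary hlamS.le
      (f := fun q => W.indicator 1 q.2.1 * (linkedPairs rp rI RI).indicator 1 q)
      ((hWm.comp (measurable_fst.comp measurable_snd)).mul hLm),
    h.lintegral_tsum_secondary hlamS.le
      (f := fun q => W.indicator 1 q.2 * {q : (ℕ → Plane × Plane) × Plane |
        PrimaryOpportunity rI RI q.1 q.2}.indicator 1 q)
      ((hWm.comp measurable_snd).mul hOm)]
  simp_rw [hnum, hden]
  rw [lintegral_mul_const _ hWm, lintegral_mul_const _ hWm, lintegral_indicator_one hW,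
    ← coe_toNNReal_mul_ofReal hlamS, ← hc]
  have hl0 : (lamS.toNNReal : ℝ≥0∞) ≠ 0 := by simpa using hlamS
  -- Cancellation in `ℝ≥0∞` needs a denominator that is neither `0` nor `∞`; positive finite area of
  -- `W` enters here.
  have hd0 : (lamS.toNNReal : ℝ≥0∞) * (volume W * p) ≠ 0 :=
    mul_ne_zero hl0 (mul_ne_zero hW0.ne' hp0)
  have hdt : (lamS.toNNReal : ℝ≥0∞) * (volume W * p) ≠ ∞ :=
    ENNReal.mul_ne_top ENNReal.coe_ne_top (ENNReal.mul_ne_top hW'.ne ENNReal.ofReal_ne_top)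
  refine (ENNReal.eq_div_iff hd0 hdt).2 ?_ |>.symm
  ring

theorem condBidirProb_eq (h : IsNetwork P lamS lamPT Rp su tx rx)
    (hlam : 0 ≤ lamPT) (hrp : 0 < rp) (hrI : 0 < rI) (hRp : 0 < Rp) (hRI : 0 < RI) (a : Plane) :
    condBidirProb P tx rx rp rI RI a = g lamPT rp rI Rp RI := by
  have := isProbabilityMeasure_uniformDisk a hrp
  have hE : MeasurableSet {p : Ω × Plane | p.1 ∈ oppEvent tx rx rI RI a} :=
    measurable_fst (h.measurableSet_oppEvent a)
  have hEP : P.prod (uniformDisk a rp) {p : Ω × Plane | p.1 ∈ oppEvent tx rx rI RI a}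
      = P (oppEvent tx rx rI RI a) := by
    have : {p : Ω × Plane | p.1 ∈ oppEvent tx rx rI RI a}
        = oppEvent tx rx rI RI a ×ˢ Set.univ := by ext; simp
    rw [this, Measure.prod_prod, measure_univ, mul_one]
  have hF : {p : Ω × Plane | p.1 ∈ oppEvent tx rx rI RI a}
        ∩ {p | p.1 ∈ oppEvent tx rx rI RI a ∧ p.1 ∈ oppEvent tx rx rI RI p.2}
      = {p | p.1 ∈ oppEvent tx rx rI RI a} ∩ {p | p.1 ∈ oppEvent tx rx rI RI p.2} := by
    ext p
    simp only [Set.mem_inter_iff, Set.mem_ofPred_eq]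
    tauto
  have hvol : volume (Metric.closedBall a rp) = ENNReal.ofReal (Real.pi * rp ^ 2) := by
    rw [← volumeReal_closedBall a hrp.le]
    exact (ENNReal.ofReal_toReal measure_closedBall_lt_top.ne).symm
  have hFP : P.prod (uniformDisk a rp) ({p | p.1 ∈ oppEvent tx rx rI RI a}
        ∩ {p | p.1 ∈ oppEvent tx rx rI RI p.2})
      = P (oppEvent tx rx rI RI a) * ENNReal.ofReal (g lamPT rp rI Rp RI) := by
    -- Slicing by the location of the second user reduces the probability to the area integral
    -- already computed, normalised by the area of the disk.
    rw [Measure.prod_apply_symm (hE.inter h.measurableSet_prod_oppEvent)]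
    have hl := h.lintegral_measure_oppEvent_inter (rI := rI) (RI := RI) hlam hrp hrI hRp hRI a
    refine (lintegral_smul_measure (R := ℝ≥0∞) (μ := volume.restrict (Metric.closedBall a rp))
      (volume (Metric.closedBall a rp))⁻¹
      (fun y => P (oppEvent tx rx rI RI a ∩ oppEvent tx rx rI RI y))).trans ?_
    rw [hl, smul_eq_mul, hvol, ENNReal.ofReal_mul (p := Real.pi * rp ^ 2) (by positivity),
      mul_left_comm, ← mul_assoc _⁻¹,
      ENNReal.inv_mul_cancel (ENNReal.ofReal_pos.2 (by positivity)).ne' ENNReal.ofReal_ne_top,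
      one_mul]
  rw [condBidirProb, measureReal_def, cond_apply hE, hEP, hF, hFP, ← mul_assoc,
    ENNReal.inv_mul_cancel (h.measure_oppEvent_ne_zero hlam hrI hRp hRI a) (measure_ne_top _ _),
    one_mul, ENNReal.toReal_ofReal (g_nonneg hrp)]

end IsNetwork

end Degrees

end HetNet

end

theorem mainTheorem6 (rp rI Rp RI : ℝ) (hrp : 0 < rp) (hrI : 0 < rI) (hRp : 0 < Rp)
    (hRI : 0 < RI) :
    (∀ {Ω : Type*} [MeasurableSpace Ω] (P : Measure Ω) [IsProbabilityMeasure P]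
      (lamS lamPT : ℝ), 0 < lamS → 0 < lamPT →
      ∀ su tx rx : ℕ → Ω → HetNet.Plane, HetNet.IsNetwork P lamS lamPT Rp su tx rx →
        (∀ a : HetNet.Plane,
          HetNet.condBidirProb P tx rx rp rI RI a = HetNet.g lamPT rp rI Rp RI) ∧
        (∀ W : Set HetNet.Plane, MeasurableSet W → 0 < volume W → volume W < ∞ →
          HetNet.condAvgDegree P su tx rx rp rI RI W
            = ENNReal.ofReal (lamS * Real.pi * rp ^ 2 * HetNet.g lamPT rp rI Rp RI)) ∧
        (∀ a : HetNet.Plane,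
          HetNet.condAvgDegreeAt P su tx rx rp rI RI a
            = ENNReal.ofReal (lamS * Real.pi * rp ^ 2 * HetNet.g lamPT rp rI Rp RI))) ∧
    StrictAntiOn (fun lamPT => HetNet.g lamPT rp rI Rp RI) (Set.Ici 0) := by
  refine ⟨fun P _ lamS lamPT hlamS hlamPT su tx rx h => ⟨fun a => ?_, fun W hW hW0 hW' => ?_,
    fun a => ?_⟩, HetNet.strictAntiOn_g hrp hrI hRp hRI⟩
  · exact h.condBidirProb_eq hlamPT.le hrp hrI hRp hRI a
  · exact h.condAvgDegree_eq hlamS hlamPT.le hrp hrI hRp hRI hW hW0 hW'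
  · exact h.condAvgDegreeAt_eq hlamS hlamPT.le hrp hrI hRp hRI a
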